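/- For $n\ge 1$ and $k\ge 1$, a unit vector of $\mathbb{C}^n\otimes\mathbb{C}^n$ is maximally entangled if it equals $\frac{1}{\sqrt n}\sum_{j} |e_j\rangle\otimes|f_j\rangle$ for some orthonormal bases $(e_j)$, $(f_j)$ of $\mathbb{C}^n$. An LOCC protocol on $\mathbb{C}^n\otimes\mathbb{C}^n$ with guesses in $\{1,\dots,k\}$ is a procedure in which, at each round, one of the two parties performs on its (finite-dimensional) local system, possibly using a finite-dimensional ancilla, a measurement with finitely many outcomes, which may depend on all previous outcomes, and communicates the outcome to the other party, until the parties stop and announce a guess in $\{1,\dots,k\}$; the number of rounds need not be bounded, but the protocol terminates with probability one on every input state. Given orthonormal vectors $|\Psi_1\rangle,\dots,|\Psi_k\rangle$ and a probability distribution $(p_1,\dots,p_k)$, let $P(\{|\Psi_i\rangle\},\{p_i\})$ be the supremum, over all such LOCC protocols, of the probability $\sum_i p_i \Pr(\text{guess}=i \mid |\Psi_i\rangle)$ that the guess is correct. Let $$f_{me}(k,n) := \min_{\{|\Psi_i\rangle\},\{p_i\}} P(\{|\Psi_i\rangle\},\{p_i\}),$$ where the minimum is over all probability distributions $(p_i)_{i=1}^k$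 and all families of $k$ orthonormal maximally entangled states in $\mathbb{C}^n\otimes\mathbb{C}^n$. Then for all integers $2\le n\le k\le n^2$ the minimum defining $f_{me}(k,n)$ is attained (in particular such families exist), and $$\frac{2}{k}\le f_{me}(k,n)\le\frac{n}{k}.$$ Moreover, for $3\le k\le 9$, $$f_{me}(k,3)=\frac{3}{k}.$$ -/

import Mathlib

open scoped Matrix Kronecker

noncomputable section

namespace LOCC

/-- The Hilbert space `ℂᵃ ⊗ ℂᵇ`, in coordinates: the coefficient of `|x⟩ ⊗ |y⟩` in `ψ` is
`ψ (x, y)`. The first factor is Alice's, the second one is Bob's. -/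
abbrev Bipartite (a b : ℕ) : Type := EuclideanSpace ℂ (Fin a × Fin b)

/-- The (unnormalized) vector `(X ⊗ I) ψ`. -/
def actAlice {a a' b : ℕ} (X : Matrix (Fin a') (Fin a) ℂ) (ψ : Bipartite a b) :
    Bipartite a' b :=
  WithLp.toLp 2 ((X ⊗ₖ (1 : Matrix (Fin b) (Fin b) ℂ)) *ᵥ ψ.ofLp)

/-- The (unnormalized) vector `(I ⊗ Y) ψ`. -/
def actBob {a b b' : ℕ} (Y : Matrix (Fin b') (Fin b) ℂ) (ψ : Bipartite a b) :
    Bipartite a b' :=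
  WithLp.toLp 2 (((1 : Matrix (Fin a) (Fin a) ℂ) ⊗ₖ Y) *ᵥ ψ.ofLp)

/-- A local measurement on a `d`-dimensional system: finitely many outcomes `j`, with
measurement operators `op j` satisfying `∑ j, (op j)† (op j) = I`. After the outcome `j` the
local system has dimension `dim j`; so adjoining a finite-dimensional ancilla, applying a
unitary, measuring, and discarding a part of the system are all covered. -/
structure LocalMeasurement (d : ℕ) where
  outcomes : ℕ
  dim : Fin outcomes → ℕ
  op : (j : Fin outcomes) → Matrix (Fin (dim j)) (Fin d) ℂ
  complete : ∑ j, (op j)ᴴ * op j = 1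

/-- What happens at a node of a protocol with answers in `Fin k`, when Alice's system has
dimension `a` and Bob's has dimension `b`: the parties stop and announce a guess, or one of them
measures the local system and tells the outcome to the other one, and the protocol continues at a
node that depends on the outcome. `S a' b'` is the type of nodes at which the local dimensions
are `a'` and `b'`. -/
inductive Step (k : ℕ) (S : ℕ → ℕ → Type) (a b : ℕ) : Type
  | guess (i : Fin k) : Step k S a b
  | alice (M : LocalMeasurement a) (next : (j : Fin M.outcomes) → S (M.dim j) b) : Step k S a b
  | bob (M : LocalMeasurement b) (next : (j : Fin M.outcomes) → S a (M.dim j)) : Step k S a b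

/-- A two-party protocol of local operations and classical communication on `ℂᵃ ⊗ ℂᵇ` that
produces a guess in `Fin k`. The nodes may record the whole list of previous outcomes, so each
measurement may depend on all of them. The number of rounds need not be bounded. -/
structure Protocol (k a b : ℕ) where
  Node : ℕ → ℕ → Type
  step : {a' b' : ℕ} → Node a' b' → Step k Node a' b'
  start : Node a b

namespace Protocol

variable {k a b : ℕ}

/-- The probability that the protocol, started at the node `s` with the state `ψ`, announces the
guess `i` after fewer than `r` measurements. For an unnormalized `ψ` this is multiplied by
`‖ψ‖²`. -/
def guessProbWithin (Q : Protocol k a b) (i : Fin k) :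
    (r : ℕ) → {a' b' : ℕ} → Q.Node a' b' → Bipartite a' b' → ℝ
  | 0, _, _, _, _ => 0
  | r + 1, _, _, s, ψ =>
    match Q.step s with
    | .guess i' => if i' = i then ‖ψ‖ ^ 2 else 0
    | .alice M next => ∑ j, guessProbWithin Q i r (next j) (actAlice (M.op j) ψ)
    | .bob M next => ∑ j, guessProbWithin Q i r (next j) (actBob (M.op j) ψ)

/-- The probability that the protocol, applied to the state `ψ`, ever announces the guess `i`:
the limit of the nondecreasing bounded sequence of the probabilities that it does so within `r`
rounds. -/
def guessProb (Q : Protocol k a b) (ψ : Bipartite a b) (i : Fin k) : ℝ :=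
  ⨆ r, Q.guessProbWithin i r Q.start ψ

/-- On every input state, the protocol announces some guess with probability one. -/
def TerminatesAlmostSurely (Q : Protocol k a b) : Prop :=
  ∀ ψ : Bipartite a b, ‖ψ‖ = 1 → ∑ i, Q.guessProb ψ i = 1

/-- `P(Z = V)`: the probability of a correct guess when the state is `Ψ i` with probability
`p i`. -/
def successProb (Q : Protocol k a b) (Ψ : Fin k → Bipartite a b) (p : Fin k → ℝ) : ℝ :=
  ∑ i, p i * Q.guessProb (Ψ i) i

end Protocol

/-- The optimal success probability `P({Ψ_i}, {p_i})`: the supremum of the success probabilities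
of all LOCC protocols that terminate with probability one. -/
def optimalSuccessProb {k a b : ℕ} (Ψ : Fin k → Bipartite a b) (p : Fin k → ℝ) : ℝ :=
  sSup {x | ∃ Q : Protocol k a b, Q.TerminatesAlmostSurely ∧ Q.successProb Ψ p = x}

/-- A vector of `ℂⁿ ⊗ ℂⁿ` is maximally entangled if it is `n^(-1/2) ∑ j, e_j ⊗ f_j` for some
orthonormal bases `e` and `f` of `ℂⁿ`, that is, if all its Schmidt coefficients are equal. -/
def IsMaximallyEntangled {n : ℕ} (ψ : Bipartite n n) : Prop :=
  ∃ e f : OrthonormalBasis (Fin n) ℂ (EuclideanSpace ℂ (Fin n)),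
    ∀ x y, ψ (x, y) = ((Real.sqrt n)⁻¹ : ℂ) * ∑ j, e j x * f j y

/-- The values `P({Ψ_i}, {p_i})` over all families of `k` orthonormal maximally entangled states
of `ℂⁿ ⊗ ℂⁿ` and all probability distributions `p`. -/
def optimalValues (k n : ℕ) : Set ℝ :=
  {x | ∃ (Ψ : Fin k → Bipartite n n) (p : Fin k → ℝ),
    Orthonormal ℂ Ψ ∧ (∀ i, IsMaximallyEntangled (Ψ i)) ∧ p ∈ stdSimplex ℝ (Fin k) ∧
      optimalSuccessProb Ψ p = x}

/-- The worst-case optimal success probability `f_me(k, n)`. -/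
def fme (k n : ℕ) : ℝ := sInf (optimalValues k n)

/-! The suprema above are taken over bounded sets. -/

lemma norm_sq_toLp_mulVec {m d : Type*} [Fintype m] [Fintype d] (X : Matrix m d ℂ)
    (v : EuclideanSpace ℂ d) :
    (‖(WithLp.toLp 2 (X *ᵥ v.ofLp) : EuclideanSpace ℂ m)‖ : ℂ) ^ 2
      = star v.ofLp ⬝ᵥ ((Xᴴ * X) *ᵥ v.ofLp) := by
  rw [← Matrix.mulVec_mulVec, Matrix.dotProduct_mulVec, Matrix.vecMul_conjTranspose, star_star]
  rw [← Complex.ofReal_pow, EuclideanSpace.norm_sq_eq]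
  simp [dotProduct, Complex.mul_conj, ← Complex.conj_mul', mul_comm]

lemma sum_norm_sq_toLp_mulVec {ι d : Type*} [Fintype ι] [Fintype d] [DecidableEq d]
    {m : ι → Type*} [∀ j, Fintype (m j)] (X : (j : ι) → Matrix (m j) d ℂ)
    (hX : ∑ j, (X j)ᴴ * X j = 1) (v : EuclideanSpace ℂ d) :
    ∑ j, ‖(WithLp.toLp 2 (X j *ᵥ v.ofLp) : EuclideanSpace ℂ (m j))‖ ^ 2 = ‖v‖ ^ 2 := by
  have h : (∑ j, (‖(WithLp.toLp 2 (X j *ᵥ v.ofLp) : EuclideanSpace ℂ (m j))‖ : ℂ) ^ 2)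
      = (‖v‖ : ℂ) ^ 2 := by
    simp_rw [norm_sq_toLp_mulVec]
    rw [← dotProduct_sum, ← Matrix.sum_mulVec, hX]
    simpa using (norm_sq_toLp_mulVec (1 : Matrix d d ℂ) v).symm
  exact_mod_cast h

lemma sum_norm_sq_actAlice {a b : ℕ} (M : LocalMeasurement a) (ψ : Bipartite a b) :
    ∑ j, ‖actAlice (M.op j) ψ‖ ^ 2 = ‖ψ‖ ^ 2 := by
  refine sum_norm_sq_toLp_mulVec
    (fun j => M.op j ⊗ₖ (1 : Matrix (Fin b) (Fin b) ℂ)) ?_ ψ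
  simp_rw [Matrix.conjTranspose_kronecker, ← Matrix.mul_kronecker_mul]
  rw [← Matrix.one_kronecker_one, ← M.complete]
  ext x y
  simp [Matrix.sum_apply, Matrix.kroneckerMap_apply, Finset.sum_mul]

lemma sum_norm_sq_actBob {a b : ℕ} (M : LocalMeasurement b) (ψ : Bipartite a b) :
    ∑ j, ‖actBob (M.op j) ψ‖ ^ 2 = ‖ψ‖ ^ 2 := by
  refine sum_norm_sq_toLp_mulVec
    (fun j => (1 : Matrix (Fin a) (Fin a) ℂ) ⊗ₖ M.op j) ?_ ψ
  simp_rw [Matrix.conjTranspose_kronecker, ← Matrix.mul_kronecker_mul]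
  rw [← Matrix.one_kronecker_one, ← M.complete]
  ext x y
  simp [Matrix.sum_apply, Matrix.kroneckerMap_apply, Finset.mul_sum]

namespace Protocol

variable {k a b : ℕ}

lemma guessProbWithin_nonneg (Q : Protocol k a b) (i : Fin k) (r : ℕ) :
    ∀ {a' b' : ℕ} (s : Q.Node a' b') (ψ : Bipartite a' b'), 0 ≤ Q.guessProbWithin i r s ψ := by
  induction r with
  | zero => intro a' b' s ψ; simp [guessProbWithin]
  | succ r ih =>
    intro a' b' s ψ
    rw [guessProbWithin]
    split
    · split_ifs <;> positivity
    · exact Finset.sum_nonneg fun j _ => ih _ _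
    · exact Finset.sum_nonneg fun j _ => ih _ _

lemma sum_guessProbWithin_le (Q : Protocol k a b) (r : ℕ) :
    ∀ {a' b' : ℕ} (s : Q.Node a' b') (ψ : Bipartite a' b'),
      ∑ i, Q.guessProbWithin i r s ψ ≤ ‖ψ‖ ^ 2 := by
  induction r with
  | zero => intro a' b' s ψ; simp [guessProbWithin]
  | succ r ih =>
    intro a' b' s ψ
    simp only [guessProbWithin]
    cases Q.step s with
    | guess i' => simp
    | alice M next =>
      simp only
      rw [Finset.sum_comm, ← sum_norm_sq_actAlice M ψ]
      exact Finset.sum_le_sum fun j _ => ih _ _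
    | bob M next =>
      simp only
      rw [Finset.sum_comm, ← sum_norm_sq_actBob M ψ]
      exact Finset.sum_le_sum fun j _ => ih _ _

lemma guessProbWithin_le (Q : Protocol k a b) (i : Fin k) (r : ℕ) {a' b' : ℕ}
    (s : Q.Node a' b') (ψ : Bipartite a' b') : Q.guessProbWithin i r s ψ ≤ ‖ψ‖ ^ 2 :=
  (Finset.single_le_sum (f := fun i => Q.guessProbWithin i r s ψ)
    (fun i _ => Q.guessProbWithin_nonneg i r s ψ) (Finset.mem_univ i)).trans
    (Q.sum_guessProbWithin_le r s ψ)

lemma bddAbove_guessProbWithin (Q : Protocol k a b) (i : Fin k) (ψ : Bipartite a b) :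
    BddAbove (Set.range fun r => Q.guessProbWithin i r Q.start ψ) :=
  ⟨‖ψ‖ ^ 2, by rintro _ ⟨r, rfl⟩; exact Q.guessProbWithin_le i r _ _⟩

lemma guessProb_le (Q : Protocol k a b) (ψ : Bipartite a b) (i : Fin k) :
    Q.guessProb ψ i ≤ ‖ψ‖ ^ 2 :=
  ciSup_le fun r => Q.guessProbWithin_le i r _ _

end Protocol

lemma bddAbove_successProb {k a b : ℕ} (Ψ : Fin k → Bipartite a b) (p : Fin k → ℝ)
    (hp : p ∈ stdSimplex ℝ (Fin k)) :
    BddAbove {x | ∃ Q : Protocol k a b, Q.TerminatesAlmostSurely ∧ Q.successProb Ψ p = x} := by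
  refine ⟨∑ i, p i * ‖Ψ i‖ ^ 2, ?_⟩
  rintro _ ⟨Q, -, rfl⟩
  exact Finset.sum_le_sum fun i _ => mul_le_mul_of_nonneg_left (Q.guessProb_le _ _) (hp.1 i)

end LOCC

end

/-! ### Diagonalization of unitary matrices; zero diagonal for one traceless unitary -/

namespace LOCC

open Matrix

/-! A maximally entangled state has coefficient matrix `U / √n` with `U` unitary, and two such
states are orthogonal exactly when `V U†` is traceless. So everything becomes a question about
unitary matrices.

Upper bound: along any branch of a protocol the parties have applied some `A ⊗ B`, the same for
every input, and the squared norm of the result is `‖A U Bᵀ‖² / n ≤ ‖A‖² ‖B‖² / n` in Frobenius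
norms. This bound does not depend on the state, is split exactly by each local measurement, and each
leaf is correct for only one index. Hence the correct-guess probabilities of all `k` states add up
to at most its value at the root, which is `n` (`sum_guessProb_le_of_unitary`). Uniform weights give
`n / k`.

Lower bound: keep `m` states of total weight at least `m / k`. If Alice measures in the basis given
by `G`, Bob's conditional states are the rows of the `G U_i`, with inner products the diagonal
entries of `G U_i U_j† G†`. If these vanish for `i ≠ j`, Bob distinguishes the states perfectly
(`sum_le_optimalSuccessProb`). A traceless unitary has zero diagonal in the Fourier transform of its
eigenbasis, which settles `m = 2`. For `m = n = 3` a common basis exists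
(`exists_unitary_conj_diag_eq_zero_three`): in the eigenbasis of the first matrix, after a change of
phases, each circulant diagonal of all three matrices sums to zero, and a Fourier transform then
clears the diagonals.

Attainment: the families form a compact set, on which the optimal success probability is lower
semicontinuous, being a supremum of continuous truncated success probabilities. -/

lemma star_mul_self_of_diagonal_mem_unitaryGroup {n : Type*} [Fintype n] [DecidableEq n]
    {d : n → ℂ} (hd : diagonal d ∈ unitaryGroup n ℂ) (i : n) : star (d i) * d i = 1 := by
  have h := congrFun (congrFun (mem_unitaryGroup_iff'.1 hd) i) i
  simpa [star_eq_conjTranspose, diagonal_conjTranspose, diagonal_mul_diagonal] using h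

/-- Off its finite spectrum, a matrix can be shifted by a complex number of modulus one to become
invertible. -/
lemma exists_isUnit_sub_of_norm_one {n : Type*} [Fintype n] [DecidableEq n] (W : Matrix n n ℂ) :
    ∃ z : ℂ, star z * z = 1 ∧ IsUnit (z • (1 : Matrix n n ℂ) - W).det := by
  by_contra! h
  have hinf : (Set.range fun z : Circle => (z : ℂ)).Infinite :=
    have : Infinite (Set.Ioc (-Real.pi) Real.pi) :=
      (Set.Ioc_infinite (by linarith [Real.pi_pos])).to_subtype
    have : Infinite Circle := Infinite.of_injective _ Circle.argEquiv.symm.injective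
    Set.infinite_range_of_injective Circle.coe_injective
  refine (charpoly_monic W).ne_zero (Polynomial.eq_zero_of_infinite_isRoot _ (hinf.mono ?_))
  rintro _ ⟨z, rfl⟩
  have hz := h z (by
    rw [Complex.star_def, ← Complex.normSq_eq_conj_mul_self]; simp)
  rw [isUnit_iff_ne_zero, not_not] at hz
  simp only [Set.mem_ofPred_eq, Polynomial.IsRoot]
  rw [eval_charpoly, ← hz]
  congr 1
  simp [smul_one_eq_diagonal, scalar_apply]

/-- The spectral theorem for unitary matrices, deduced from the one for Hermitian matrices by a
Cayley transform. -/
lemma exists_unitary_diagonalization {n : Type*} [Fintype n] [DecidableEq n] {W : Matrix n n ℂ}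
    (hW : W ∈ unitaryGroup n ℂ) :
    ∃ G ∈ unitaryGroup n ℂ, ∃ d : n → ℂ, W = G * diagonal d * star G := by
  obtain ⟨z, hz, hu⟩ := exists_isUnit_sub_of_norm_one W
  set M : Matrix n n ℂ := z • 1 - W with hM
  have hWW := mem_unitaryGroup_iff'.1 hW
  set K : Matrix n n ℂ := (Complex.I • (z • 1 + W)) * M⁻¹ with hK
  have hKM : K * M = Complex.I • (z • 1 + W) := by
    rw [hK, Matrix.mul_assoc, nonsing_inv_mul _ hu, Matrix.mul_one]
  -- This is `M† K M = M† K† M` written without the inverse in `K`; it holds because `W† W = 1` and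
  -- `|z| = 1`.
  have hcomm : star M * (Complex.I • (z • 1 + W)) = star (Complex.I • (z • 1 + W)) * M := by
    simp only [hM, star_sub, star_add, star_smul, star_one, sub_mul, add_mul, mul_sub, mul_add,
      smul_mul_assoc, mul_smul_comm, one_mul, mul_one, smul_smul, smul_sub, smul_add, hWW]
    simp only [Complex.star_def, Complex.conj_I] at hz ⊢
    have h1 : z * (starRingEnd ℂ) z = 1 := by rw [mul_comm]; exact hz
    ext i j
    simp only [Matrix.add_apply, Matrix.sub_apply, Matrix.smul_apply, smul_eq_mul, map_mul,
      Complex.conj_I]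
    linear_combination (2 * Complex.I * (1 : Matrix n n ℂ) i j) * h1
  have hKh : K.IsHermitian := by
    have hu' : IsUnit (star M).det := by
      rw [star_eq_conjTranspose, det_conjTranspose]; exact hu.star
    have e : star M * (K * M) = star M * (star K * M) := by
      rw [hKM, hcomm, ← hKM, star_mul, Matrix.mul_assoc]
    have e1 : K * M = star K * M := by
      have := congrArg ((star M)⁻¹ * ·) e
      simpa only [← Matrix.mul_assoc, nonsing_inv_mul _ hu', Matrix.one_mul] using this
    have e2 := congrArg (· * M⁻¹) e1
    simp only [Matrix.mul_assoc, mul_nonsing_inv _ hu, Matrix.mul_one] at e2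
    exact e2.symm
  set G := hKh.eigenvectorUnitary with hG
  have hGG : star (G : Matrix n n ℂ) * G = 1 := UnitaryGroup.star_mul_self G
  have hGG' : (G : Matrix n n ℂ) * star (G : Matrix n n ℂ) = 1 := mem_unitaryGroup_iff.1 G.2
  have hsp : K = G * diagonal (fun i => ((hKh.eigenvalues i : ℝ) : ℂ)) * star (G : Matrix n n ℂ) := by
    conv_lhs => rw [hKh.spectral_theorem, Unitary.conjStarAlgAut_apply]
    rfl
  set W' : Matrix n n ℂ := star (G : Matrix n n ℂ) * W * G with hW'
  -- The relation `K M = i (z + W)` in the eigenbasis of `K`. Off the diagonal it reads `(λ_i + i)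
  -- W'_ij = 0`, and `λ_i` is real, so `W'` is diagonal.
  have key : diagonal (fun i => ((hKh.eigenvalues i : ℝ) : ℂ)) * (z • 1 - W')
      = Complex.I • (z • 1 + W') := by
    have h := congrArg (fun X => star (G : Matrix n n ℂ) * X * G) hKM
    have e1 : star (G : Matrix n n ℂ) * (K * M) * G =
        (star (G : Matrix n n ℂ) * G) * diagonal (fun i => ((hKh.eigenvalues i : ℝ) : ℂ)) *
          (star (G : Matrix n n ℂ) * M * G) := by
      conv_lhs => rw [hsp]
      simp only [Matrix.mul_assoc]
    rw [e1, hGG, Matrix.one_mul] at h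
    simpa [hM, mul_add, mul_sub, add_mul, sub_mul, hGG, hW'] using h
  have hdiag : W' = diagonal (fun i => W' i i) := by
    ext i j
    by_cases hij : i = j
    · subst hij; simp
    · rw [diagonal_apply_ne _ hij]
      have h := congrFun (congrFun key i) j
      rw [diagonal_mul] at h
      simp only [Matrix.sub_apply, Matrix.add_apply, Matrix.smul_apply, one_apply_ne hij, smul_eq_mul,
        mul_zero, zero_sub, zero_add] at h
      have h2 : (((hKh.eigenvalues i : ℝ) : ℂ) + Complex.I) * W' i j = 0 := by
        linear_combination -h
      refine (mul_eq_zero.1 h2).resolve_left fun h3 => ?_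
      simpa using congrArg Complex.im h3
  refine ⟨G, G.2, fun i => W' i i, ?_⟩
  rw [← hdiag, hW']
  calc W = ((G : Matrix n n ℂ) * star (G : Matrix n n ℂ)) * W *
        ((G : Matrix n n ℂ) * star (G : Matrix n n ℂ)) := by rw [hGG']; simp
    _ = _ := by simp only [Matrix.mul_assoc]

/-- The discrete Fourier transform is a unitary matrix with entries of equal moduli. -/
lemma exists_unitary_flat (n : ℕ) (hn : n ≠ 0) :
    ∃ F ∈ unitaryGroup (Fin n) ℂ, ∀ i j, F i j * star (F i j) = (n : ℂ)⁻¹ := by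
  have hζ := Complex.isPrimitiveRoot_exp n hn
  set ζ := Complex.exp (2 * Real.pi * Complex.I / n)
  have hs : ζ * star ζ = 1 := by
    rw [Complex.star_def, Complex.mul_conj, Complex.normSq_eq_norm_sq, hζ.norm'_eq_one hn]; simp
  have hsq : ((Real.sqrt n : ℝ) : ℂ)⁻¹ * ((Real.sqrt n : ℝ) : ℂ)⁻¹ = (n : ℂ)⁻¹ := by
    rw [← mul_inv, ← Complex.ofReal_mul, Real.mul_self_sqrt (by positivity)]; simp
  have hn' : (n : ℂ) ≠ 0 := by exact_mod_cast hn
  refine ⟨of fun i j => ((Real.sqrt n : ℝ) : ℂ)⁻¹ * ζ ^ ((i : ℕ) * j), ?_, fun i j => ?_⟩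
  · rw [mem_unitaryGroup_iff]
    ext i j
    have e : ∀ l : Fin n, ((Real.sqrt n : ℝ) : ℂ)⁻¹ * ζ ^ ((i : ℕ) * l) *
        star (((Real.sqrt n : ℝ) : ℂ)⁻¹ * ζ ^ ((j : ℕ) * l)) =
        (n : ℂ)⁻¹ * (ζ ^ (i : ℕ) * star ζ ^ (j : ℕ)) ^ (l : ℕ) := by
      intro l
      rw [star_mul', star_pow, star_inv₀, Complex.star_def, Complex.conj_ofReal, mul_pow, pow_mul,
        pow_mul, ← hsq]
      ring
    simp only [mul_apply, star_apply, of_apply, e, ← Finset.mul_sum]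
    rw [Fin.sum_univ_eq_sum_range (fun l => (ζ ^ (i : ℕ) * star ζ ^ (j : ℕ)) ^ l) n]
    by_cases hij : i = j
    · subst hij
      simp only [← mul_pow, hs, one_pow]
      simp [hn']
    · rw [one_apply_ne hij]
      have h0 := mul_geom_sum (ζ ^ (i : ℕ) * star ζ ^ (j : ℕ)) n
      have h1 : (ζ ^ (i : ℕ) * star ζ ^ (j : ℕ)) ^ n = 1 := by
        rw [mul_pow, ← pow_mul, ← pow_mul, mul_comm (i : ℕ), mul_comm (j : ℕ), pow_mul, pow_mul,
          ← star_pow, hζ.pow_eq_one]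
        simp
      rw [h1, sub_self] at h0
      rw [(mul_eq_zero.1 h0).resolve_left, mul_zero]
      intro h2
      apply hij
      refine Fin.ext (hζ.pow_inj i.2 j.2 ?_)
      calc ζ ^ (i : ℕ) = (ζ ^ (i : ℕ) * star ζ ^ (j : ℕ)) * ζ ^ (j : ℕ) := by
            rw [mul_assoc, ← mul_pow, mul_comm (star ζ), hs, one_pow, mul_one]
        _ = ζ ^ (j : ℕ) := by rw [sub_eq_zero.1 h2, one_mul]
  · simp only [of_apply]
    rw [star_mul', star_pow, star_inv₀, Complex.star_def, Complex.conj_ofReal, mul_mul_mul_comm, hsq,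
      ← mul_pow, ← Complex.star_def, hs, one_pow, mul_one]

/-- A traceless unitary matrix is unitarily similar to a matrix with zero diagonal. -/
lemma exists_unitary_conj_diag_eq_zero {n : ℕ} {W : Matrix (Fin n) (Fin n) ℂ}
    (hW : W ∈ unitaryGroup (Fin n) ℂ) (htr : W.trace = 0) :
    ∃ G ∈ unitaryGroup (Fin n) ℂ, ∀ t, (G * W * star G) t t = 0 := by
  rcases eq_or_ne n 0 with rfl | hn
  · exact ⟨1, one_mem _, fun t => t.elim0⟩
  obtain ⟨H, hH, d, rfl⟩ := exists_unitary_diagonalization hW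
  obtain ⟨F, hF, hflat⟩ := exists_unitary_flat n hn
  refine ⟨F * star H, mul_mem hF (Unitary.star_mem hH), fun t => ?_⟩
  have hHH := mem_unitaryGroup_iff'.1 hH
  have e : F * star H * (H * diagonal d * star H) * star (F * star H)
      = F * (star H * H) * diagonal d * (star H * H) * star F := by
    simp only [star_mul, star_star, Matrix.mul_assoc]
  rw [e, hHH, Matrix.mul_one, Matrix.mul_one, mul_apply]
  rw [trace_mul_comm, ← Matrix.mul_assoc, hHH, Matrix.one_mul, trace_diagonal] at htr
  -- Flatness of `F` makes every diagonal entry of `F D F†` the average of the eigenvalues.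
  calc ∑ j, (F * diagonal d) t j * (star F) j t = ∑ j, (n : ℂ)⁻¹ * d j := by
        refine Finset.sum_congr rfl fun j _ => ?_
        rw [mul_diagonal, star_apply, ← hflat t j]; ring
    _ = 0 := by rw [← Finset.mul_sum, htr, mul_zero]

end LOCC

/-! ### Pairs of traceless unitary `3 × 3` matrices in circulant form -/

namespace LOCC

open Matrix

section CubeRoot

variable {ω : ℂ} (hω : ω ^ 2 + ω + 1 = 0)
include hω

lemma pow_three_eq_one_of_cyclotomic : ω ^ 3 = 1 := by linear_combination (ω - 1) * hω

lemma norm_eq_one_of_cyclotomic : ‖ω‖ = 1 := by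
  have h := congrArg norm (pow_three_eq_one_of_cyclotomic hω)
  rw [norm_pow, norm_one] at h
  exact (pow_eq_one_iff_of_nonneg (norm_nonneg _) (by norm_num)).1 h

lemma star_eq_sq_of_cyclotomic : star ω = ω ^ 2 := by
  have h : ω * star ω = 1 := by
    rw [Complex.star_def, Complex.mul_conj, Complex.normSq_eq_norm_sq,
      norm_eq_one_of_cyclotomic hω]; simp
  linear_combination ω ^ 2 * h - star ω * pow_three_eq_one_of_cyclotomic hω

end CubeRoot

lemma star_mul_self_of_norm_one {u : ℂ} (h : ‖u‖ = 1) : star u * u = 1 := by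
  rw [Complex.star_def, ← Complex.normSq_eq_conj_mul_self, Complex.normSq_eq_norm_sq, h]; simp

/-- Three complex numbers of modulus one with sum zero form an equilateral triangle. -/
lemma exists_cyclotomic_of_add_eq_zero {d : Fin 3 → ℂ} (h : ∀ i, star (d i) * d i = 1)
    (hs : d 0 + d 1 + d 2 = 0) :
    ∃ ω : ℂ, ω ^ 2 + ω + 1 = 0 ∧ d 1 = d 0 * ω ∧ d 2 = d 0 * ω ^ 2 := by
  have hs' : star (d 0) + star (d 1) + star (d 2) = 0 := by
    rw [← star_add, ← star_add, hs, star_zero]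
  have key : (star (d 0) * d 1) ^ 2 + star (d 0) * d 1 + 1 = 0 := by
    -- The conjugate of `d i` is its inverse, so the conjugated sum, multiplied by `d 0 * d 1 * d
    -- 2`, is the second elementary symmetric function.
    have e2 : d 1 * d 2 + d 0 * d 2 + d 0 * d 1 = 0 := by
      linear_combination d 0 * d 1 * d 2 * hs' - d 1 * d 2 * h 0 - d 0 * d 2 * h 1 -
        d 0 * d 1 * h 2
    have e3 : d 1 ^ 2 + d 0 * d 1 + d 0 ^ 2 = 0 := by
      linear_combination (d 0 + d 1) * hs - e2
    linear_combination star (d 0) ^ 2 * e3 - (star (d 0) * d 1 + star (d 0) * d 0 + 1) * h 0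
  refine ⟨star (d 0) * d 1, key, ?_, ?_⟩
  · linear_combination -d 1 * h 0
  · have e : d 2 = -d 0 - d 1 := by linear_combination hs
    linear_combination e - d 0 * key + d 1 * h 0

/-- The second elementary symmetric function of the eigenvalues of a traceless unitary `3 × 3`
matrix vanishes. -/
lemma sum_minors_eq_zero {V : Matrix (Fin 3) (Fin 3) ℂ} (hV : V ∈ unitaryGroup (Fin 3) ℂ)
    (htr : V.trace = 0) :
    V 0 0 * V 1 1 - V 0 1 * V 1 0 + (V 0 0 * V 2 2 - V 0 2 * V 2 0) +
      (V 1 1 * V 2 2 - V 1 2 * V 2 1) = 0 := by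
  -- The trace of the adjugate is the sum of the principal minors, while the trace of `V†` vanishes
  -- with that of `V`.
  have h : V.adjugate = V.det • star V := by
    calc V.adjugate = V.adjugate * (V * star V) := by rw [mem_unitaryGroup_iff.1 hV, mul_one]
      _ = _ := by rw [← Matrix.mul_assoc, adjugate_mul, smul_mul_assoc, one_mul]
  have h2 := congrArg trace h
  rw [trace_smul, star_eq_conjTranspose, trace_conjTranspose, htr, star_zero, smul_zero,
    adjugate_fin_three, trace_fin_three] at h2
  simp at h2
  linear_combination h2

/-- Three complex numbers of equal moduli can be brought to the form `a, a ω², a ω` by the phase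
changes that a conjugation by a diagonal unitary matrix causes in a cycle of entries. -/
lemma exists_phases {ω p q r : ℂ} (hω : ω ^ 2 + ω + 1 = 0) (hpq : ‖p‖ = ‖q‖) (hqr : ‖q‖ = ‖r‖) :
    ∃ a u v : ℂ, star u * u = 1 ∧ star v * v = 1 ∧
      p * u = a ∧ q * star u * v = a * ω ^ 2 ∧ r * star v = a * ω := by
  by_cases hp : p = 0
  · have hq : q = 0 := by rw [← norm_eq_zero, ← hpq, hp, norm_zero]
    have hr : r = 0 := by rw [← norm_eq_zero, ← hqr, hq, norm_zero]
    exact ⟨0, 1, 1, by simp, by simp, by simp [hp], by simp [hq], by simp [hr]⟩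
  -- The phases cancel in the product of the three entries, and `a · a ω² · a ω = a³`, so `a` must
  -- be a cube root of `p q r`.
  obtain ⟨a, ha⟩ := IsAlgClosed.exists_pow_nat_eq (p * q * r) (n := 3) (by norm_num)
  have hp0 : 0 < ‖p‖ := norm_pos_iff.2 hp
  have hq : q ≠ 0 := norm_pos_iff.1 (hpq ▸ hp0)
  have hr : r ≠ 0 := norm_pos_iff.1 (hqr ▸ hpq ▸ hp0)
  have hω1 := norm_eq_one_of_cyclotomic hω
  have hω3 := pow_three_eq_one_of_cyclotomic hω
  have hω0 : ω ≠ 0 := norm_pos_iff.1 (hω1 ▸ one_pos)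
  have hna : ‖a‖ = ‖p‖ := by
    have h := congrArg norm ha
    rw [norm_pow, norm_mul, norm_mul, ← hqr, ← hpq] at h
    exact (pow_left_inj₀ (norm_nonneg _) (norm_nonneg _) (n := 3) (by norm_num)).1
      (by rw [h]; ring)
  have ha0 : a ≠ 0 := norm_pos_iff.1 (hna ▸ hp0)
  have hu : ‖a / p‖ = 1 := by rw [norm_div, hna, div_self hp0.ne']
  have hv : ‖a * ω ^ 2 * (a / p) / q‖ = 1 := by
    rw [norm_div, norm_mul, norm_mul, hu, norm_pow, hω1, hna, hpq]
    simp [hq]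
  have hinv : ∀ {u : ℂ}, ‖u‖ = 1 → star u = u⁻¹ := fun h =>
    eq_inv_of_mul_eq_one_left (star_mul_self_of_norm_one h)
  refine ⟨a, a / p, a * ω ^ 2 * (a / p) / q, star_mul_self_of_norm_one hu,
    star_mul_self_of_norm_one hv, by field_simp, ?_, ?_⟩
  · rw [hinv hu]; field_simp
  · rw [hinv hv]; field_simp
    linear_combination -ha - a ^ 3 * hω3

/-- The entries of a traceless unitary matrix `V` whose product with `diag(1, ω², ω)` is traceless
as well, up to a conjugation by a diagonal unitary matrix. -/
lemma exists_circulant_form {ω : ℂ} (hω : ω ^ 2 + ω + 1 = 0) {V : Matrix (Fin 3) (Fin 3) ℂ}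
    (hV : V ∈ unitaryGroup (Fin 3) ℂ) (htr : V.trace = 0)
    (htr' : (diagonal ![1, ω ^ 2, ω] * V).trace = 0) :
    ∃ a b c u v : ℂ, star u * u = 1 ∧ star v * v = 1 ∧
      V 0 0 = c ∧ V 1 1 = c * ω ^ 2 ∧ V 2 2 = c * ω ∧
      V 0 1 * u = a ∧ V 1 2 * star u * v = a * ω ^ 2 ∧ V 2 0 * star v = a * ω ∧
      V 1 0 * star u = b ∧ V 2 1 * u * star v = b * ω ^ 2 ∧ V 0 2 * v = b * ω := by
  have hω1 := norm_eq_one_of_cyclotomic hω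
  have hω3 := pow_three_eq_one_of_cyclotomic hω
  have hstar := star_eq_sq_of_cyclotomic hω
  have hD : diagonal ![1, ω ^ 2, ω] ∈ unitaryGroup (Fin 3) ℂ := by
    rw [mem_unitaryGroup_iff, star_eq_conjTranspose, diagonal_conjTranspose,
      diagonal_mul_diagonal, ← diagonal_one]
    congr 1
    ext i
    fin_cases i
    · simp
    · simp only [Pi.star_apply, Fin.mk_one, cons_val_one, cons_val_zero, star_pow, hstar]
      linear_combination (ω ^ 3 + 1) * hω3
    · simp only [Pi.star_apply, Fin.reduceFinMk, cons_val, hstar]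
      linear_combination hω3
  have m1 := sum_minors_eq_zero hV htr
  have m2 := sum_minors_eq_zero (mul_mem hD hV) htr'
  simp only [diagonal_mul, cons_val_zero, cons_val_one, cons_val] at m2
  rw [trace_fin_three] at htr htr'
  simp only [diagonal_mul, cons_val_zero, cons_val_one, cons_val] at htr'
  have hω1' : ω ≠ 1 := by rintro rfl; norm_num at hω
  have hωs : ω - 1 ≠ 0 := sub_ne_zero.2 hω1'
  -- The two trace conditions are linear in the diagonal of `V` and force it to be a multiple of
  -- `(1, ω², ω)`.
  have d1 : V 1 1 = V 0 0 * ω ^ 2 := by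
    apply mul_left_cancel₀ hωs
    linear_combination htr' * ω ^ 2 - htr * ω ^ 3 - V 1 1 * (ω - 1) * hω3
  have d2 : V 2 2 = V 0 0 * ω := by
    linear_combination htr - d1 - V 0 0 * hω
  -- The diagonal contributes zero to both sums of minors, leaving two linear equations that fix the
  -- ratios of the three products of opposite entries.
  have x1 : V 0 1 * V 1 0 + V 0 2 * V 2 0 + V 1 2 * V 2 1 = 0 := by
    rw [d1, d2] at m1
    linear_combination -m1 + V 0 0 ^ 2 * ω * hω
  have x2 : ω ^ 2 * (V 0 1 * V 1 0) + ω * (V 0 2 * V 2 0) + V 1 2 * V 2 1 = 0 := by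
    rw [d1, d2] at m2
    linear_combination -m2 + V 0 0 ^ 2 * hω + (V 0 0 ^ 2 * (ω ^ 3 + 1 + ω) - V 1 2 * V 2 1) * hω3
  have x3 : V 0 1 * V 1 0 = ω ^ 2 * (V 1 2 * V 2 1) := by
    apply mul_left_cancel₀ hωs
    linear_combination -ω ^ 3 * x1 + ω ^ 2 * x2 - V 0 1 * V 1 0 * (ω - 1) * hω3
  have x4 : V 2 0 * V 0 2 = ω * (V 1 2 * V 2 1) := by
    linear_combination x1 - x3 - V 1 2 * V 2 1 * hω
  have row : ∀ i, Complex.normSq (V i 0) + Complex.normSq (V i 1) + Complex.normSq (V i 2) = 1 := by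
    intro i
    have h := congrFun (congrFun (mem_unitaryGroup_iff.1 hV) i) i
    simp only [mul_apply, star_apply, Fin.sum_univ_three, Complex.star_def, Complex.mul_conj,
      one_apply_eq] at h
    exact_mod_cast h
  have col : ∀ i, Complex.normSq (V 0 i) + Complex.normSq (V 1 i) + Complex.normSq (V 2 i) = 1 := by
    intro i
    have h := congrFun (congrFun (mem_unitaryGroup_iff'.1 hV) i) i
    simp only [mul_apply, star_apply, Fin.sum_univ_three, Complex.star_def,
      ← Complex.normSq_eq_conj_mul_self, one_apply_eq] at h
    exact_mod_cast h
  have hN : Complex.normSq ω = 1 := by rw [Complex.normSq_eq_norm_sq, hω1]; norm_num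
  have n1 : Complex.normSq (V 1 1) = Complex.normSq (V 0 0) := by
    rw [d1, map_mul, map_pow, hN]; simp
  have n2 : Complex.normSq (V 2 2) = Complex.normSq (V 0 0) := by
    rw [d2, map_mul, hN]; simp
  have norm_eq : ∀ {x y : ℂ}, Complex.normSq x = Complex.normSq y → ‖x‖ = ‖y‖ := by
    intro x y h
    rwa [Complex.normSq_eq_norm_sq, Complex.normSq_eq_norm_sq,
      pow_left_inj₀ (norm_nonneg _) (norm_nonneg _) (by norm_num)] at h
  have e1 : ‖V 0 1‖ = ‖V 1 2‖ := norm_eq (by linarith [row 0, col 2])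
  have e2 : ‖V 1 2‖ = ‖V 2 0‖ := norm_eq (by linarith [row 1, col 0])
  have e3 : ‖V 1 0‖ = ‖V 2 1‖ := norm_eq (by linarith [row 2, col 0])
  have e4 : ‖V 2 1‖ = ‖V 0 2‖ := norm_eq (by linarith [row 0, col 1])
  by_cases h01 : V 0 1 = 0
  · have h12 : V 1 2 = 0 := by rw [← norm_eq_zero, ← e1, h01, norm_zero]
    have h20 : V 2 0 = 0 := by rw [← norm_eq_zero, ← e2, h12, norm_zero]
    obtain ⟨b, u, v, hu, hv, f1, f2, f3⟩ := exists_phases hω e3 e4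
    -- One cycle of entries is zero, so the phases are spent on the reversed cycle, where they enter
    -- conjugated.
    refine ⟨0, b, V 0 0, star u, star v, ?_, ?_, rfl, d1, d2, ?_, ?_, ?_, ?_, ?_, f3⟩
    · rw [star_star, mul_comm]; exact hu
    · rw [star_star, mul_comm]; exact hv
    · rw [h01, zero_mul]
    · rw [h12]; ring
    · rw [h20]; ring
    · rw [star_star]; exact f1
    · rw [star_star]; exact f2
  · obtain ⟨a, u, v, hu, hv, f1, f2, f3⟩ := exists_phases hω e1 e2
    have hu0 : u ≠ 0 := right_ne_zero_of_mul_eq_one hu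
    have ha : a ≠ 0 := f1 ▸ mul_ne_zero h01 hu0
    refine ⟨a, V 1 0 * star u, V 0 0, u, v, hu, hv, rfl, d1, d2, f1, f2, f3, rfl, ?_, ?_⟩
    · apply mul_left_cancel₀ ha
      have g : a * (V 1 0 * star u) = V 0 1 * V 1 0 := by
        rw [← f1]; linear_combination V 0 1 * V 1 0 * hu
      have g' : a * ω ^ 2 * (V 2 1 * u * star v) = V 1 2 * V 2 1 := by
        rw [← f2]
        linear_combination V 1 2 * V 2 1 * (star v * v * hu + hv)
      linear_combination ω * g' - a * (V 2 1 * u * star v) * hω3 - ω ^ 2 * g -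
        ω ^ 2 * x3 - ω * V 1 2 * V 2 1 * hω3
    · apply mul_left_cancel₀ ha
      have g : a * (V 1 0 * star u) = V 0 1 * V 1 0 := by
        rw [← f1]; linear_combination V 0 1 * V 1 0 * hu
      have g' : a * ω * (V 0 2 * v) = V 2 0 * V 0 2 := by
        rw [← f3]; linear_combination V 2 0 * V 0 2 * hv
      linear_combination ω ^ 2 * g' - a * (V 0 2 * v) * hω3 - ω * g - ω * x3 + ω ^ 2 * x4

end LOCC

/-! ### A common basis with zero diagonals in dimension three -/

namespace LOCC

open Matrix

/-- The Fourier transform of order three turns a matrix whose three circulant diagonals sum to zero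
into a matrix with zero diagonal. -/
lemma exists_unitary_three_diag_eq_zero {ω : ℂ} (hω : ω ^ 2 + ω + 1 = 0) :
    ∃ F ∈ unitaryGroup (Fin 3) ℂ, ∀ X : Matrix (Fin 3) (Fin 3) ℂ,
      X 0 0 + X 1 1 + X 2 2 = 0 → X 0 1 + X 1 2 + X 2 0 = 0 → X 1 0 + X 2 1 + X 0 2 = 0 →
      ∀ t, (F * X * star F) t t = 0 := by
  have hω3 := pow_three_eq_one_of_cyclotomic hω
  have hstar := star_eq_sq_of_cyclotomic hω
  have hs : star ((Real.sqrt 3 : ℝ) : ℂ)⁻¹ = ((Real.sqrt 3 : ℝ) : ℂ)⁻¹ := by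
    rw [star_inv₀, Complex.star_def, Complex.conj_ofReal]
  have hsq : ((Real.sqrt 3 : ℝ) : ℂ)⁻¹ * ((Real.sqrt 3 : ℝ) : ℂ)⁻¹ = 3⁻¹ := by
    rw [← mul_inv, ← Complex.ofReal_mul, Real.mul_self_sqrt (by norm_num)]; simp
  set s := ((Real.sqrt 3 : ℝ) : ℂ)⁻¹
  have hsF : star (s • !![1, 1, 1; 1, ω ^ 2, ω; 1, ω, ω ^ 2]) =
      s • !![1, 1, 1; 1, ω, ω ^ 2; 1, ω ^ 2, ω] := by
    have h4 : (ω ^ 2) ^ 2 = ω := by linear_combination ω * hω3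
    rw [star_smul, hs]
    congr 1
    ext i j
    fin_cases i <;> fin_cases j <;> simp [star_apply, -RCLike.star_def, hstar, h4]
  refine ⟨s • !![1, 1, 1; 1, ω ^ 2, ω; 1, ω, ω ^ 2], ?_, fun X h0 h1 h2 t => ?_⟩
  · rw [mem_unitaryGroup_iff, hsF, smul_mul_smul_comm, hsq]
    ext i j
    fin_cases i <;> fin_cases j <;> simp
    all_goals first
      | linear_combination hω
      | linear_combination hω + ω * hω3
      | linear_combination 3⁻¹ * 2 * hω3
      | norm_num
  · rw [hsF, Matrix.smul_mul, smul_mul_smul_comm, hsq, Matrix.smul_apply, smul_eq_mul]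
    apply mul_eq_zero_of_right
    fin_cases t <;> simp [mul_apply, vecMul, dotProduct, Fin.sum_univ_three]
    · linear_combination h0 + h1 + h2
    · linear_combination h0 + ω * h1 + ω ^ 2 * h2 + (X 1 1 + X 2 2 + ω * X 1 2) * hω3
    · linear_combination h0 + ω ^ 2 * h1 + ω * h2 + (X 1 1 + X 2 2 + ω * X 2 1) * hω3

lemma diagonal_mem_unitaryGroup {n : Type*} [Fintype n] [DecidableEq n] {d : n → ℂ}
    (hd : ∀ i, star (d i) * d i = 1) : diagonal d ∈ unitaryGroup n ℂ := by
  rw [mem_unitaryGroup_iff', star_eq_conjTranspose, diagonal_conjTranspose,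
    diagonal_mul_diagonal, ← diagonal_one]
  congr 1
  ext i
  exact hd i

/-- Two traceless unitary `3 × 3` matrices `U` and `V` such that `U† V` is traceless: the three
matrices have zero diagonals in a common orthonormal basis. -/
lemma exists_unitary_conj_diag_eq_zero_three {U V : Matrix (Fin 3) (Fin 3) ℂ}
    (hU : U ∈ unitaryGroup (Fin 3) ℂ) (hV : V ∈ unitaryGroup (Fin 3) ℂ)
    (hUt : U.trace = 0) (hVt : V.trace = 0) (hUVt : (star U * V).trace = 0) :
    ∃ G ∈ unitaryGroup (Fin 3) ℂ, ∀ t, (G * U * star G) t t = 0 ∧ (G * V * star G) t t = 0 ∧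
      (G * (star U * V) * star G) t t = 0 := by
  obtain ⟨H, hH, d, rfl⟩ := exists_unitary_diagonalization hU
  have hHH := mem_unitaryGroup_iff'.1 hH
  have hHH' := mem_unitaryGroup_iff.1 hH
  have hD : diagonal d ∈ unitaryGroup (Fin 3) ℂ := by
    have h := mul_mem (mul_mem (Unitary.star_mem hH) hU) hH
    have e : star H * (H * diagonal d * star H) * H
        = (star H * H) * diagonal d * (star H * H) := by simp only [Matrix.mul_assoc]
    rwa [e, hHH, Matrix.one_mul, Matrix.mul_one] at h
  have hd := star_mul_self_of_diagonal_mem_unitaryGroup hD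
  rw [trace_mul_comm, ← Matrix.mul_assoc, hHH, Matrix.one_mul, trace_diagonal,
    Fin.sum_univ_three] at hUt
  obtain ⟨ω, hω, hd1, hd2⟩ := exists_cyclotomic_of_add_eq_zero hd hUt
  have hω3 := pow_three_eq_one_of_cyclotomic hω
  have hstar := star_eq_sq_of_cyclotomic hω
  set W := star H * V * H with hW
  have hWu : W ∈ unitaryGroup (Fin 3) ℂ := mul_mem (mul_mem (Unitary.star_mem hH) hV) hH
  have hWt : W.trace = 0 := by
    rw [hW, trace_mul_comm, ← Matrix.mul_assoc, hHH', Matrix.one_mul, hVt]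
  have hsd : star d = star (d 0) • ![1, ω ^ 2, ω] := by
    ext i
    fin_cases i
    · simp
    · simp [hd1, -RCLike.star_def, hstar]
    · simp [hd2, -RCLike.star_def, hstar]
      left
      linear_combination ω * hω3
  have hsD : star (diagonal d) = star (d 0) • diagonal ![1, ω ^ 2, ω] := by
    rw [star_eq_conjTranspose, diagonal_conjTranspose, hsd, diagonal_smul]
  have hVW : V = H * W * star H := by
    calc V = (H * star H) * V * (H * star H) := by rw [hHH']; simp
      _ = _ := by simp only [hW, Matrix.mul_assoc]
  have hUVW : star (H * diagonal d * star H) * V = H * (star (diagonal d) * W) * star H := by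
    rw [hVW]
    calc _ = H * (star (diagonal d) * (star H * H) * W) * star H := by
          simp only [star_mul, star_star, Matrix.mul_assoc]
      _ = _ := by rw [hHH, Matrix.mul_one]
  have hd0 : star (d 0) ≠ 0 := left_ne_zero_of_mul_eq_one (hd 0)
  have hWt' : (diagonal ![1, ω ^ 2, ω] * W).trace = 0 := by
    rw [hUVW, trace_mul_comm, ← Matrix.mul_assoc, hHH, Matrix.one_mul, hsD, smul_mul_assoc,
      trace_smul, smul_eq_mul] at hUVt
    exact (mul_eq_zero.1 hUVt).resolve_left hd0
  obtain ⟨a, b, c, u, v, hu, hv, w00, w11, w22, w01, w12, w20, w10, w21, w02⟩ :=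
    exists_circulant_form hω hWu hWt hWt'
  obtain ⟨F, hF, hFX⟩ := exists_unitary_three_diag_eq_zero hω
  have hE : diagonal ![1, u, v] ∈ unitaryGroup (Fin 3) ℂ :=
    diagonal_mem_unitaryGroup fun i => by
      fin_cases i
      · simp
      · exact hu
      · exact hv
  set E := diagonal ![1, u, v] with hEdef
  have hsE : star E = diagonal ![1, star u, star v] := by
    rw [star_eq_conjTranspose, diagonal_conjTranspose]
    congr 1
    ext i
    fin_cases i <;> simp
  have conj : ∀ X : Matrix (Fin 3) (Fin 3) ℂ,
      F * star E * star H * (H * X * star H) * star (F * star E * star H)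
        = F * (star E * X * E) * star F := by
    intro X
    calc _ = F * (star E * (star H * H) * X * (star H * H) * E) * star F := by
          simp only [star_mul, star_star, Matrix.mul_assoc]
      _ = _ := by rw [hHH]; simp only [Matrix.mul_one]
  have entry : ∀ (X : Matrix (Fin 3) (Fin 3) ℂ) i j,
      (star E * X * E) i j = ![1, star u, star v] i * X i j * ![1, u, v] j := by
    intro X i j
    rw [hsE, hEdef, mul_diagonal, diagonal_mul]
  -- `H` diagonalizes `U`, `E` corrects phases without changing the diagonal matrix, and `F` is the
  -- Fourier transform.
  refine ⟨F * star E * star H, mul_mem (mul_mem hF (Unitary.star_mem hE)) (Unitary.star_mem hH),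
    fun t => ⟨?_, ?_, ?_⟩⟩
  · rw [conj]
    apply hFX <;> simp only [entry, cons_val_zero, cons_val_one, cons_val, diagonal_apply_eq]
    · rw [hd1, hd2]
      linear_combination d 0 * hω + d 0 * ω * hu + d 0 * ω ^ 2 * hv
    · simp
    · simp
  · rw [hVW, conj]
    apply hFX <;> simp only [entry, cons_val_zero, cons_val_one, cons_val]
    · linear_combination w00 + star u * u * w11 + star v * v * w22 + c * ω ^ 2 * hu +
        c * ω * hv + c * hω
    · linear_combination w01 + w12 + w20 + a * hω
    · linear_combination w10 + w21 + w02 + b * hω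
  · rw [hUVW, conj]
    apply hFX <;> simp only [entry, cons_val_zero, cons_val_one, cons_val, hsD,
      Matrix.smul_mul, Matrix.smul_apply, diagonal_mul, smul_eq_mul]
    · linear_combination star (d 0) * (w00 + ω ^ 2 * star u * u * w11 + ω * star v * v * w22 +
        c * ω ^ 4 * hu + c * ω ^ 2 * hv + c * hω + c * ω * hω3)
    · linear_combination star (d 0) * (w01 + ω ^ 2 * w12 + ω * w20 + a * hω + a * ω * hω3)
    · linear_combination star (d 0) * (ω ^ 2 * w10 + ω * w21 + w02 + b * hω + b * hω3)

end LOCC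

/-! ### Guess probabilities as limits over the number of rounds -/

namespace LOCC

open Matrix Filter Topology

namespace Protocol

variable {k a b : ℕ}

lemma guessProbWithin_mono (Q : Protocol k a b) (i : Fin k) (r : ℕ) :
    ∀ {a' b' : ℕ} (s : Q.Node a' b') (ψ : Bipartite a' b'),
      Q.guessProbWithin i r s ψ ≤ Q.guessProbWithin i (r + 1) s ψ := by
  induction r with
  | zero => intro a' b' s ψ; exact Q.guessProbWithin_nonneg i _ s ψ
  | succ r ih =>
    intro a' b' s ψ
    rw [guessProbWithin, guessProbWithin]
    cases Q.step s with
    | guess i' => simp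
    | alice M next => exact Finset.sum_le_sum fun j _ => ih _ _
    | bob M next => exact Finset.sum_le_sum fun j _ => ih _ _

lemma tendsto_guessProbWithin (Q : Protocol k a b) (i : Fin k) (ψ : Bipartite a b) :
    Tendsto (fun r => Q.guessProbWithin i r Q.start ψ) atTop (𝓝 (Q.guessProb ψ i)) :=
  tendsto_atTop_ciSup (monotone_nat_of_le_succ fun r => Q.guessProbWithin_mono i r _ _)
    (Q.bddAbove_guessProbWithin i ψ)

lemma guessProbWithin_le_guessProb (Q : Protocol k a b) (i : Fin k) (r : ℕ) (ψ : Bipartite a b) :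
    Q.guessProbWithin i r Q.start ψ ≤ Q.guessProb ψ i :=
  le_ciSup (Q.bddAbove_guessProbWithin i ψ) r

lemma guessProb_nonneg (Q : Protocol k a b) (ψ : Bipartite a b) (i : Fin k) :
    0 ≤ Q.guessProb ψ i :=
  (Q.guessProbWithin_nonneg i 0 _ _).trans (Q.guessProbWithin_le_guessProb i 0 ψ)

lemma sum_guessProb_le (Q : Protocol k a b) (ψ : Bipartite a b) :
    ∑ i, Q.guessProb ψ i ≤ ‖ψ‖ ^ 2 :=
  le_of_tendsto (tendsto_finsetSum _ fun i _ => Q.tendsto_guessProbWithin i ψ)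
    (Eventually.of_forall fun r => Q.sum_guessProbWithin_le r _ _)

/-- A protocol that stops within a fixed number of rounds terminates almost surely. -/
lemma terminatesAlmostSurely_of_sum_guessProbWithin (Q : Protocol k a b) (r : ℕ)
    (h : ∀ ψ : Bipartite a b, ∑ i, Q.guessProbWithin i r Q.start ψ = ‖ψ‖ ^ 2) :
    Q.TerminatesAlmostSurely := by
  intro ψ hψ
  refine le_antisymm ((Q.sum_guessProb_le ψ).trans_eq (by rw [hψ, one_pow])) ?_
  calc (1 : ℝ) = ∑ i, Q.guessProbWithin i r Q.start ψ := by rw [h, hψ, one_pow]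
    _ ≤ _ := Finset.sum_le_sum fun i _ => Q.guessProbWithin_le_guessProb i r ψ

end Protocol

/-! ### The upper bound -/

/-- The square of the Frobenius norm. -/
noncomputable def frobSq {m n : Type*} [Fintype m] [Fintype n] (A : Matrix m n ℂ) : ℝ :=
  ∑ x, ∑ y, ‖A x y‖ ^ 2

section frobSq

variable {m n l : Type*} [Fintype m] [Fintype n] [Fintype l]

lemma frobSq_nonneg (A : Matrix m n ℂ) : 0 ≤ frobSq A := by unfold frobSq; positivity

lemma coe_frobSq (A : Matrix m n ℂ) : (frobSq A : ℂ) = (A * Aᴴ).trace := by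
  simp [frobSq, trace, mul_apply, Complex.mul_conj, Complex.normSq_eq_norm_sq]

lemma frobSq_one [DecidableEq n] : frobSq (1 : Matrix n n ℂ) = Fintype.card n := by
  have h := coe_frobSq (1 : Matrix n n ℂ)
  rw [conjTranspose_one, mul_one, trace_one] at h
  exact_mod_cast h

lemma frobSq_mul_unitary [DecidableEq n] (A : Matrix m n ℂ) {U : Matrix n n ℂ}
    (hU : U ∈ unitaryGroup n ℂ) : frobSq (A * U) = frobSq A := by
  have h : (frobSq (A * U) : ℂ) = frobSq A := by
    rw [coe_frobSq, coe_frobSq, conjTranspose_mul, ← star_eq_conjTranspose U, Matrix.mul_assoc,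
      ← Matrix.mul_assoc U, mem_unitaryGroup_iff.1 hU, Matrix.one_mul]
  exact_mod_cast h

/-- Cauchy–Schwarz in each entry. The transpose appears because Bob's operators act on coefficient
matrices in this way (`coeff_actBob`). -/
lemma frobSq_mul_transpose_le (A : Matrix m n ℂ) (B : Matrix l n ℂ) :
    frobSq (A * Bᵀ) ≤ frobSq A * frobSq B := by
  unfold frobSq
  rw [Finset.sum_mul_sum]
  refine Finset.sum_le_sum fun x _ => Finset.sum_le_sum fun y _ => ?_
  calc ‖(A * Bᵀ) x y‖ ^ 2 ≤ (∑ z, ‖A x z‖ * ‖B y z‖) ^ 2 := by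
        gcongr
        rw [mul_apply]
        exact (norm_sum_le _ _).trans_eq (by simp)
    _ ≤ _ := Finset.sum_mul_sq_le_sq_mul_sq _ _ _

/-- Completeness under the trace: the bound carried along a protocol is distributed over the
outcomes without loss. -/
lemma sum_frobSq_op_mul {d : ℕ} (M : LocalMeasurement d) (A : Matrix (Fin d) n ℂ) :
    ∑ j, frobSq (M.op j * A) = frobSq A := by
  have h : (∑ j, (frobSq (M.op j * A) : ℂ)) = frobSq A := by
    have e : ∀ j, (M.op j * A * (M.op j * A)ᴴ).trace = ((M.op j)ᴴ * M.op j * (A * Aᴴ)).trace := by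
      intro j
      rw [conjTranspose_mul, ← Matrix.mul_assoc, trace_mul_comm]
      simp only [Matrix.mul_assoc]
    simp_rw [coe_frobSq, e]
    rw [← trace_sum, ← Finset.sum_mul, M.complete, Matrix.one_mul]
  exact_mod_cast h

end frobSq

section act

variable {a a' a'' b b' b'' : ℕ}

lemma actAlice_apply (X : Matrix (Fin a') (Fin a) ℂ) (ψ : Bipartite a b) (x : Fin a') (y : Fin b) :
    actAlice X ψ (x, y) = ∑ z, X x z * ψ (z, y) := by
  simp [actAlice, mulVec, dotProduct, Fintype.sum_prod_type, one_apply]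

lemma actBob_apply (Y : Matrix (Fin b') (Fin b) ℂ) (ψ : Bipartite a b) (x : Fin a) (y : Fin b') :
    actBob Y ψ (x, y) = ∑ z, Y y z * ψ (x, z) := by
  simp [actBob, mulVec, dotProduct, Fintype.sum_prod_type, one_apply]

lemma actAlice_one (ψ : Bipartite a b) : actAlice 1 ψ = ψ := by simp [actAlice]

lemma actBob_one (ψ : Bipartite a b) : actBob 1 ψ = ψ := by simp [actBob]

lemma actAlice_actAlice (X : Matrix (Fin a'') (Fin a') ℂ) (Y : Matrix (Fin a') (Fin a) ℂ)
    (ψ : Bipartite a b) : actAlice X (actAlice Y ψ) = actAlice (X * Y) ψ := by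
  simp [actAlice, ← mul_kronecker_mul]

lemma actBob_actBob (X : Matrix (Fin b'') (Fin b') ℂ) (Y : Matrix (Fin b') (Fin b) ℂ)
    (ψ : Bipartite a b) : actBob X (actBob Y ψ) = actBob (X * Y) ψ := by
  simp [actBob, ← mul_kronecker_mul]

lemma actBob_actAlice (Y : Matrix (Fin b') (Fin b) ℂ) (X : Matrix (Fin a') (Fin a) ℂ)
    (ψ : Bipartite a b) : actBob Y (actAlice X ψ) = actAlice X (actBob Y ψ) := by
  simp [actAlice, actBob, ← mul_kronecker_mul]

/-- The matrix of coefficients of a bipartite vector. -/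
def coeff (ψ : Bipartite a b) : Matrix (Fin a) (Fin b) ℂ := of fun x y => ψ (x, y)

lemma coeff_actAlice (X : Matrix (Fin a') (Fin a) ℂ) (ψ : Bipartite a b) :
    coeff (actAlice X ψ) = X * coeff ψ := by
  ext x y; simp [coeff, actAlice_apply, mul_apply]

lemma coeff_actBob (Y : Matrix (Fin b') (Fin b) ℂ) (ψ : Bipartite a b) :
    coeff (actBob Y ψ) = coeff ψ * Yᵀ := by
  ext x y; simp [coeff, actBob_apply, mul_apply, mul_comm]

lemma norm_sq_eq_frobSq_coeff (ψ : Bipartite a b) : ‖ψ‖ ^ 2 = frobSq (coeff ψ) := by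
  rw [EuclideanSpace.norm_sq_eq, Fintype.sum_prod_type]; rfl

end act

lemma smul_frobSq {m n : Type*} [Fintype m] [Fintype n] (c : ℂ) (A : Matrix m n ℂ) :
    frobSq (c • A) = ‖c‖ ^ 2 * frobSq A := by
  simp [frobSq, mul_pow, Finset.mul_sum]

/-- Local operators act on a state with unitary coefficient matrix with a gain of at most the
product of their Frobenius norms. -/
lemma norm_sq_actAlice_actBob_le {n a b : ℕ} (A : Matrix (Fin a) (Fin n) ℂ)
    (B : Matrix (Fin b) (Fin n) ℂ) {ψ : Bipartite n n} {c : ℂ} {U : Matrix (Fin n) (Fin n) ℂ}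
    (hU : U ∈ unitaryGroup (Fin n) ℂ) (hψ : coeff ψ = c • U) :
    ‖actAlice A (actBob B ψ)‖ ^ 2 ≤ ‖c‖ ^ 2 * (frobSq A * frobSq B) := by
  rw [norm_sq_eq_frobSq_coeff, coeff_actAlice, coeff_actBob, hψ, Matrix.smul_mul, Matrix.mul_smul,
    smul_frobSq, ← Matrix.mul_assoc]
  gcongr
  exact (frobSq_mul_transpose_le _ _).trans_eq (by rw [frobSq_mul_unitary _ hU])

namespace Protocol

variable {k n : ℕ}

/-- Induction on the rounds, for arbitrary accumulated operators `A` and `B`, which do not depend on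
`i`. At a leaf only the announced index contributes; at a measurement the right-hand side splits
over the outcomes. -/
lemma sum_guessProbWithin_actAlice_actBob_le (Q : Protocol k n n) {Ψ : Fin k → Bipartite n n}
    {c : ℂ} {U : Fin k → Matrix (Fin n) (Fin n) ℂ} (hU : ∀ i, U i ∈ unitaryGroup (Fin n) ℂ)
    (hΨ : ∀ i, coeff (Ψ i) = c • U i) (r : ℕ) :
    ∀ {a b : ℕ} (s : Q.Node a b) (A : Matrix (Fin a) (Fin n) ℂ) (B : Matrix (Fin b) (Fin n) ℂ),
      ∑ i, Q.guessProbWithin i r s (actAlice A (actBob B (Ψ i))) ≤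
        ‖c‖ ^ 2 * (frobSq A * frobSq B) := by
  induction r with
  | zero =>
    intro a b s A B
    have := frobSq_nonneg A
    have := frobSq_nonneg B
    simp only [guessProbWithin, Finset.sum_const_zero]
    positivity
  | succ r ih =>
    intro a b s A B
    simp only [guessProbWithin]
    cases Q.step s with
    | guess i' =>
      simpa using norm_sq_actAlice_actBob_le A B (hU i') (hΨ i')
    | alice M next =>
      simp only
      rw [Finset.sum_comm, ← sum_frobSq_op_mul M A, Finset.sum_mul, Finset.mul_sum]
      refine Finset.sum_le_sum fun j _ => ?_
      simp_rw [actAlice_actAlice]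
      exact ih _ _ _
    | bob M next =>
      simp only
      rw [Finset.sum_comm, ← sum_frobSq_op_mul M B, Finset.mul_sum, Finset.mul_sum]
      refine Finset.sum_le_sum fun j _ => ?_
      simp_rw [actBob_actAlice, actBob_actBob]
      exact ih _ _ _

/-- On states with unitary coefficient matrices, the probabilities of a correct guess add up to at
most the local dimension. -/
lemma sum_guessProb_le_of_unitary (Q : Protocol k n n) {Ψ : Fin k → Bipartite n n}
    {c : ℂ} {U : Fin k → Matrix (Fin n) (Fin n) ℂ} (hU : ∀ i, U i ∈ unitaryGroup (Fin n) ℂ)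
    (hΨ : ∀ i, coeff (Ψ i) = c • U i) :
    ∑ i, Q.guessProb (Ψ i) i ≤ ‖c‖ ^ 2 * (n * n) := by
  refine le_of_tendsto (tendsto_finsetSum _ fun i _ => Q.tendsto_guessProbWithin i (Ψ i))
    (Eventually.of_forall fun r => ?_)
  have h := Q.sum_guessProbWithin_actAlice_actBob_le hU hΨ r Q.start 1 1
  simpa only [actAlice_one, actBob_one, frobSq_one, Fintype.card_fin] using h

end Protocol

/-! ### Protocols with finitely many rounds -/

/-- The tree of a protocol with finitely many rounds. -/
inductive Tree (k : ℕ) : ℕ → ℕ → Type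
  | guess {a b : ℕ} (i : Fin k) : Tree k a b
  | alice {a b : ℕ} (M : LocalMeasurement a)
      (next : (j : Fin M.outcomes) → Tree k (M.dim j) b) : Tree k a b
  | bob {a b : ℕ} (M : LocalMeasurement b)
      (next : (j : Fin M.outcomes) → Tree k a (M.dim j)) : Tree k a b

namespace Tree

variable {k a b : ℕ}

/-- The first step of a tree. -/
def step : {a b : ℕ} → Tree k a b → Step k (Tree k) a b
  | _, _, guess i => .guess i
  | _, _, alice M next => .alice M next
  | _, _, bob M next => .bob M next

/-- The protocol described by a tree. -/
def toProtocol (T : Tree k a b) : Protocol k a b := ⟨Tree k, step, T⟩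

end Tree

/-- Keeps the set in `optimalSuccessProb` nonempty, so that its supremum is meaningful. -/
lemma exists_terminatesAlmostSurely {k a b : ℕ} (hk : 0 < k) :
    ∃ Q : Protocol k a b, Q.TerminatesAlmostSurely := by
  refine ⟨(Tree.guess ⟨0, hk⟩ : Tree k a b).toProtocol,
    Protocol.terminatesAlmostSurely_of_sum_guessProbWithin _ 1 fun ψ => ?_⟩
  simp [Protocol.guessProbWithin, Tree.toProtocol, Tree.step]

/-- The measurement in the orthonormal basis given by the conjugated rows of a unitary matrix. -/
def basisMeasurement {n : ℕ} {G : Matrix (Fin n) (Fin n) ℂ} (hG : G ∈ unitaryGroup (Fin n) ℂ) :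
    LocalMeasurement n where
  outcomes := n
  dim _ := 1
  op j := of fun _ y => G j y
  complete := by
    rw [← mem_unitaryGroup_iff'.1 hG]
    ext x y
    simp [Matrix.sum_apply, mul_apply]

/-- The protocol in which Alice measures in the basis `G`, then Bob measures in a basis that
depends on Alice's outcome, and the guess depends on both outcomes. -/
def oneWay {k n : ℕ} {G : Matrix (Fin n) (Fin n) ℂ} (hG : G ∈ unitaryGroup (Fin n) ℂ)
    {B : Fin n → Matrix (Fin n) (Fin n) ℂ} (hB : ∀ j, B j ∈ unitaryGroup (Fin n) ℂ)
    (g : Fin n → Fin k) : Protocol k n n :=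
  (Tree.alice (basisMeasurement hG) fun j =>
    Tree.bob (basisMeasurement (hB j)) fun l => Tree.guess (g l)).toProtocol

section oneWay

variable {k n : ℕ} {G : Matrix (Fin n) (Fin n) ℂ} (hG : G ∈ unitaryGroup (Fin n) ℂ)
  {B : Fin n → Matrix (Fin n) (Fin n) ℂ} (hB : ∀ j, B j ∈ unitaryGroup (Fin n) ℂ) (g : Fin n → Fin k)

/-- Two measurements and the announcement consume exactly three steps. -/
lemma oneWay_guessProbWithin (i : Fin k) (ψ : Bipartite n n) :
    (oneWay hG hB g).guessProbWithin i 3 (oneWay hG hB g).start ψ =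
      ∑ j, ∑ l, if g l = i then ‖actBob ((basisMeasurement (hB j)).op l)
        (actAlice ((basisMeasurement hG).op j) ψ)‖ ^ 2 else 0 := rfl

lemma oneWay_terminatesAlmostSurely : (oneWay hG hB g).TerminatesAlmostSurely := by
  refine Protocol.terminatesAlmostSurely_of_sum_guessProbWithin _ 3 fun ψ => ?_
  simp_rw [oneWay_guessProbWithin]
  rw [Finset.sum_comm, ← sum_norm_sq_actAlice (basisMeasurement hG) ψ]
  refine Finset.sum_congr rfl fun j _ => ?_
  rw [Finset.sum_comm, ← sum_norm_sq_actBob (basisMeasurement (hB j))]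
  refine Finset.sum_congr rfl fun l _ => ?_
  simp

lemma norm_sq_actBob_actAlice_basisMeasurement (ψ : Bipartite n n) (j l : Fin n) :
    ‖actBob ((basisMeasurement (hB j)).op l) (actAlice ((basisMeasurement hG).op j) ψ)‖ ^ 2 =
      ‖∑ y, B j l y * (G * coeff ψ) j y‖ ^ 2 := by
  rw [EuclideanSpace.norm_sq_eq]
  change ∑ i : Fin 1 × Fin 1, _ = _
  rw [Fintype.sum_prod_type]
  simp only [Fin.sum_univ_one, actBob_apply, actAlice_apply, basisMeasurement, of_apply, mul_apply, coeff]

/-- The probability of the guess `i` in a one-way protocol is at least the probability of any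
specified outcome of Bob that leads to it. -/
lemma le_oneWay_guessProb (ψ : Bipartite n n) (l : Fin n) :
    ∑ j, ‖∑ y, B j l y * (G * coeff ψ) j y‖ ^ 2 ≤ (oneWay hG hB g).guessProb ψ (g l) := by
  refine le_trans ?_ (Protocol.guessProbWithin_le_guessProb _ _ 3 _)
  rw [oneWay_guessProbWithin]
  refine Finset.sum_le_sum fun j _ => ?_
  rw [← norm_sq_actBob_actAlice_basisMeasurement hG hB]
  refine le_trans (by rw [if_pos rfl]) (Finset.single_le_sum (f := fun l' => if g l' = g l then
    ‖actBob ((basisMeasurement (hB j)).op l')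
        (actAlice ((basisMeasurement hG).op j) ψ)‖ ^ 2 else 0) (fun l' _ => ?_) (Finset.mem_univ l))
  split_ifs <;> positivity

end oneWay

end LOCC

namespace LOCC

open Matrix Filter Topology

/-! ### Maximally entangled states and unitary matrices -/

lemma mem_unitaryGroup_iff_orthonormal_rows {n : ℕ}
    {v : Fin n → EuclideanSpace ℂ (Fin n)} :
    (of fun i y => v i y) ∈ unitaryGroup (Fin n) ℂ ↔ Orthonormal ℂ v := by
  have e : ∀ i j, ((of fun i y => v i y) * star (of fun i y => v i y)) i j = inner ℂ (v j) (v i) := by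
    intro i j
    simp [mul_apply, PiLp.inner_apply]
  rw [mem_unitaryGroup_iff, orthonormal_iff_ite]
  constructor
  · intro h i j
    rw [← e, h, one_apply]
    simp only [eq_comm]
  · intro h
    ext i j
    rw [e, h, one_apply]
    simp only [eq_comm]

/-- The orthonormal basis that consists of the rows of a unitary matrix. -/
lemma exists_orthonormalBasis_rows {n : ℕ} {U : Matrix (Fin n) (Fin n) ℂ}
    (hU : U ∈ unitaryGroup (Fin n) ℂ) :
    ∃ f : OrthonormalBasis (Fin n) ℂ (EuclideanSpace ℂ (Fin n)), ∀ j y, f j y = U j y := by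
  have h : Orthonormal ℂ (fun j => (WithLp.toLp 2 (U j) : EuclideanSpace ℂ (Fin n))) :=
    mem_unitaryGroup_iff_orthonormal_rows.1 hU
  obtain ⟨b, hb⟩ := Orthonormal.exists_orthonormalBasis_extension_of_card_eq (𝕜 := ℂ)
    (by simp) (v := fun j => (WithLp.toLp 2 (U j) : EuclideanSpace ℂ (Fin n)))
    (s := Set.univ) (h.comp _ Subtype.val_injective)
  exact ⟨b, fun j y => by rw [hb j (Set.mem_univ _)]⟩

/-- The coefficient matrix is `eᵀ f / √n` with the basis vectors as rows; conversely, `e` can be the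
standard basis and `f` the rows of `U`. -/
lemma isMaximallyEntangled_iff {n : ℕ} {ψ : Bipartite n n} :
    IsMaximallyEntangled ψ ↔
      ∃ U ∈ unitaryGroup (Fin n) ℂ, coeff ψ = ((Real.sqrt n)⁻¹ : ℂ) • U := by
  constructor
  · rintro ⟨e, f, h⟩
    refine ⟨(of fun j x => e j x)ᵀ * of fun j y => f j y, mul_mem ?_ ?_, ?_⟩
    · exact transpose_mem_unitaryGroup_iff.2
        (mem_unitaryGroup_iff_orthonormal_rows.2 e.orthonormal)
    · exact mem_unitaryGroup_iff_orthonormal_rows.2 f.orthonormal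
    · ext x y
      simp [coeff, h, mul_apply]
  · rintro ⟨U, hU, h⟩
    obtain ⟨f, hf⟩ := exists_orthonormalBasis_rows hU
    refine ⟨EuclideanSpace.basisFun _ ℂ, f, fun x y => ?_⟩
    have h' := congrFun (congrFun h x) y
    simpa [coeff, hf, Pi.single_apply] using h'

lemma norm_sq_inv_sqrt {n : ℕ} : ‖((Real.sqrt n)⁻¹ : ℂ)‖ ^ 2 = (n : ℝ)⁻¹ := by
  rw [norm_inv, Complex.norm_real, Real.norm_of_nonneg (Real.sqrt_nonneg _), inv_pow,
    Real.sq_sqrt (Nat.cast_nonneg n)]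

lemma inner_eq_trace {a b : ℕ} (ψ φ : Bipartite a b) :
    inner ℂ ψ φ = (coeff φ * (coeff ψ)ᴴ).trace := by
  simp [PiLp.inner_apply, Fintype.sum_prod_type, trace, mul_apply, coeff]

lemma trace_eq_zero_of_inner_eq_zero {n : ℕ} (hn : n ≠ 0) {ψ φ : Bipartite n n}
    {U V : Matrix (Fin n) (Fin n) ℂ} (hψ : coeff ψ = ((Real.sqrt n)⁻¹ : ℂ) • U)
    (hφ : coeff φ = ((Real.sqrt n)⁻¹ : ℂ) • V) (h : inner ℂ ψ φ = 0) : (V * star U).trace = 0 := by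
  have hs : ((Real.sqrt n)⁻¹ : ℂ) ≠ 0 := by
    rw [← norm_ne_zero_iff, ← pow_ne_zero_iff two_ne_zero, norm_sq_inv_sqrt]
    positivity
  rw [inner_eq_trace, hψ, hφ, conjTranspose_smul, Matrix.smul_mul, Matrix.mul_smul, trace_smul,
    trace_smul, smul_eq_mul, smul_eq_mul] at h
  exact ((mul_eq_zero.1 h).resolve_left hs |> mul_eq_zero.1).resolve_left (star_ne_zero.2 hs)

/-! ### The lower bound -/

lemma Protocol.successProb_le_optimalSuccessProb {k a b : ℕ} {Q : Protocol k a b}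
    (hQ : Q.TerminatesAlmostSurely) (Ψ : Fin k → Bipartite a b) {p : Fin k → ℝ}
    (hp : p ∈ stdSimplex ℝ (Fin k)) : Q.successProb Ψ p ≤ optimalSuccessProb Ψ p :=
  le_csSup (bddAbove_successProb Ψ p hp) ⟨Q, hQ, rfl⟩

/-- A unitary matrix with prescribed orthonormal first rows. -/
lemma exists_unitary_extension {m n : ℕ} (hmn : m ≤ n) (w : Fin m → Fin n → ℂ)
    (hw : ∀ i j, ∑ y, w i y * star (w j y) = if i = j then 1 else 0) :
    ∃ B ∈ unitaryGroup (Fin n) ℂ, ∀ i y, B (Fin.castLE hmn i) y = star (w i y) := by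
  -- The zero vectors are placeholders: the extension is only required to agree with `v` on the
  -- first `m` indices.
  let v : Fin n → EuclideanSpace ℂ (Fin n) := fun l =>
    if h : (l : ℕ) < m then WithLp.toLp 2 (star (w ⟨l, h⟩)) else 0
  have hv : ∀ i, v (Fin.castLE hmn i) = WithLp.toLp 2 (star (w i)) := fun i => by simp [v]
  have ho : Orthonormal ℂ ((Set.range (Fin.castLE hmn)).domRestrict v) := by
    rw [orthonormal_iff_ite]
    rintro ⟨x, hx⟩ ⟨y, hy⟩
    obtain ⟨i, rfl⟩ := id hx
    obtain ⟨j, rfl⟩ := id hy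
    simp only [Subtype.mk.injEq, (Fin.castLE_injective hmn).eq_iff]
    rw [← hw i j, Set.domRestrict_apply, Set.domRestrict_apply, hv, hv]
    simp [PiLp.inner_apply, mul_comm]
  obtain ⟨b, hb⟩ := Orthonormal.exists_orthonormalBasis_extension_of_card_eq (by simp) ho
  refine ⟨of fun l y => b l y, mem_unitaryGroup_iff_orthonormal_rows.2 b.orthonormal,
    fun i y => ?_⟩
  rw [of_apply, hb _ ⟨i, rfl⟩, hv]
  rfl

/-- If in some orthonormal basis of Alice's system the products `U i (U j)†` have zero diagonals,
then the corresponding maximally entangled states can be distinguished perfectly, after a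
measurement of Alice in that basis. -/
lemma sum_le_optimalSuccessProb {k m n : ℕ} (hn : n ≠ 0) (hk : 0 < k) (hmn : m ≤ n)
    {Ψ : Fin k → Bipartite n n}
    {U : Fin k → Matrix (Fin n) (Fin n) ℂ} (hU : ∀ i, U i ∈ unitaryGroup (Fin n) ℂ)
    (hΨ : ∀ i, coeff (Ψ i) = ((Real.sqrt n)⁻¹ : ℂ) • U i) {p : Fin k → ℝ}
    (hp : p ∈ stdSimplex ℝ (Fin k)) (σ : Fin m → Fin k) (hσ : σ.Injective)
    {G : Matrix (Fin n) (Fin n) ℂ} (hG : G ∈ unitaryGroup (Fin n) ℂ)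
    (hdiag : ∀ i j, i ≠ j → ∀ t, (G * (U (σ i) * star (U (σ j))) * star G) t t = 0) :
    ∑ i, p (σ i) ≤ optimalSuccessProb Ψ p := by
  -- After Alice's outcome `t`, Bob holds a multiple of row `t` of `G * U (σ i)`; `hdiag` makes
  -- these rows orthonormal in `i`.
  have key : ∀ t : Fin n, ∃ B ∈ unitaryGroup (Fin n) ℂ,
      ∀ i y, B (Fin.castLE hmn i) y = star ((G * U (σ i)) t y) := by
    intro t
    refine exists_unitary_extension hmn (fun i y => (G * U (σ i)) t y) fun i j => ?_
    have e : ∑ y, (G * U (σ i)) t y * star ((G * U (σ j)) t y)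
        = (G * (U (σ i) * star (U (σ j))) * star G) t t := by
      have e' : G * (U (σ i) * star (U (σ j))) * star G
          = (G * U (σ i)) * star (G * U (σ j)) := by simp only [star_mul, Matrix.mul_assoc]
      rw [e', mul_apply]
      rfl
    rw [e]
    split_ifs with hij
    · subst hij
      rw [mem_unitaryGroup_iff.1 (hU _), Matrix.mul_one, mem_unitaryGroup_iff.1 hG, one_apply_eq]
    · exact hdiag i j hij t
  choose B hB hBw using key
  -- The default guess is arbitrary, since the first `m` outcomes already carry all the probability
  -- on the selected states.
  let g : Fin n → Fin k := fun l => if h : (l : ℕ) < m then σ ⟨l, h⟩ else ⟨0, hk⟩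
  have hg : ∀ i, g (Fin.castLE hmn i) = σ i := fun i => by simp [g]
  have hprob : ∀ i, 1 ≤ (oneWay hG hB g).guessProb (Ψ (σ i)) (σ i) := by
    intro i
    have h := le_oneWay_guessProb hG hB g (Ψ (σ i)) (Fin.castLE hmn i)
    rw [hg] at h
    refine le_trans (le_of_eq ?_) h
    have e : ∀ t, ∑ y, B t (Fin.castLE hmn i) y * (G * coeff (Ψ (σ i))) t y
        = ((Real.sqrt n)⁻¹ : ℂ) := by
      intro t
      have h1 := congrFun (congrFun (mem_unitaryGroup_iff'.1 (hB t)) t) t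
      have h2 := congrFun (congrFun (mem_unitaryGroup_iff.1 (mul_mem hG (hU (σ i)))) t) t
      rw [mul_apply, one_apply_eq] at h2
      calc _ = ((Real.sqrt n)⁻¹ : ℂ) * ∑ y, (G * U (σ i)) t y * star (G * U (σ i)) y t := by
            rw [Finset.mul_sum]
            refine Finset.sum_congr rfl fun y _ => ?_
            rw [hBw, hΨ, Matrix.mul_smul, Matrix.smul_apply, smul_eq_mul, star_apply]
            ring
        _ = _ := by rw [h2, mul_one]
    simp_rw [e, norm_sq_inv_sqrt]
    simp [hn]
  refine le_trans ?_ (Protocol.successProb_le_optimalSuccessProb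
    (oneWay_terminatesAlmostSurely hG hB g) Ψ hp)
  calc ∑ i, p (σ i) ≤ ∑ i, p (σ i) * (oneWay hG hB g).guessProb (Ψ (σ i)) (σ i) :=
        Finset.sum_le_sum fun i _ => le_mul_of_one_le_right (hp.1 _) (hprob i)
    _ = ∑ l ∈ Finset.univ.map ⟨σ, hσ⟩, p l * (oneWay hG hB g).guessProb (Ψ l) l := by
        rw [Finset.sum_map]; rfl
    _ ≤ _ := Finset.sum_le_sum_of_subset_of_nonneg (Finset.subset_univ _) fun l _ _ =>
        mul_nonneg (hp.1 l) (Protocol.guessProb_nonneg _ _ _)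

/-- Some `m` of the `k` probabilities add up to at least `m / k`. -/
lemma exists_injective_div_le_sum {k m : ℕ} (hk : 0 < k) (hmk : m ≤ k) {p : Fin k → ℝ}
    (hp : p ∈ stdSimplex ℝ (Fin k)) :
    ∃ σ : Fin m → Fin k, σ.Injective ∧ (m : ℝ) / k ≤ ∑ i, p (σ i) := by
  have : NeZero k := ⟨hk.ne'⟩
  -- Averaging over the cyclic shifts `c` of the first `m` indices: for fixed `i` the sum over `c`
  -- is the total weight `1`.
  have hsum : ∑ c : Fin k, (m : ℝ) / k ≤ ∑ c : Fin k, ∑ i : Fin m, p (c + Fin.castLE hmk i) := by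
    rw [Finset.sum_comm]
    have h : ∀ i : Fin m, ∑ c : Fin k, p (c + Fin.castLE hmk i) = 1 := fun i => by
      rw [← hp.2]
      exact Equiv.sum_comp (Equiv.addRight (Fin.castLE hmk i)) p
    simp_rw [h]
    simp only [Finset.sum_const, Finset.card_univ, Fintype.card_fin, nsmul_eq_mul, mul_one]
    rw [mul_div_cancel₀ _ (by positivity)]
  obtain ⟨c, -, hc⟩ := Finset.exists_le_of_sum_le Finset.univ_nonempty hsum
  exact ⟨fun i => c + Fin.castLE hmk i,
    fun i j h => Fin.castLE_injective hmk (add_left_cancel h), hc⟩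

section lower

variable {k n : ℕ} {Ψ : Fin k → Bipartite n n} {p : Fin k → ℝ}

lemma two_div_le_optimalSuccessProb (hn : 2 ≤ n) (hk : 2 ≤ k) (hΨ : Orthonormal ℂ Ψ)
    (hme : ∀ i, IsMaximallyEntangled (Ψ i)) (hp : p ∈ stdSimplex ℝ (Fin k)) :
    2 / (k : ℝ) ≤ optimalSuccessProb Ψ p := by
  obtain ⟨σ, hσ, hle⟩ := exists_injective_div_le_sum (by omega) hk hp
  choose U hU hc using fun i => isMaximallyEntangled_iff.1 (hme i)
  have hn0 : n ≠ 0 := by omega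
  have h01 : σ 0 ≠ σ 1 := hσ.ne (by decide)
  obtain ⟨G, hG, h0⟩ := exists_unitary_conj_diag_eq_zero
    (mul_mem (hU (σ 0)) (Unitary.star_mem (hU (σ 1))))
    (trace_eq_zero_of_inner_eq_zero hn0 (hc _) (hc _) (hΨ.2 h01.symm))
  refine le_trans (by exact_mod_cast hle)
    (sum_le_optimalSuccessProb hn0 (by omega) hn hU hc hp σ hσ hG ?_)
  have hsymm : ∀ t, (G * (U (σ 1) * star (U (σ 0))) * star G) t t = 0 := by
    intro t
    have h := congrArg star (h0 t)
    rw [star_zero, ← star_apply] at h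
    simpa only [star_mul, star_star, Matrix.mul_assoc] using h
  intro i j hij t
  fin_cases i <;> fin_cases j
  · exact absurd rfl hij
  · exact h0 t
  · exact hsymm t
  · exact absurd rfl hij

/-- The pair `U₀ U₁†`, `U₀ U₂†` has relative product `(U₀ U₁†)† U₀ U₂† = U₁ U₂†`, so one basis
handles all three pairs; the reversed pairs are adjoints. -/
lemma three_div_le_optimalSuccessProb {Ψ : Fin k → Bipartite 3 3} (hk : 3 ≤ k)
    (hΨ : Orthonormal ℂ Ψ) (hme : ∀ i, IsMaximallyEntangled (Ψ i))
    (hp : p ∈ stdSimplex ℝ (Fin k)) : 3 / (k : ℝ) ≤ optimalSuccessProb Ψ p := by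
  obtain ⟨σ, hσ, hle⟩ := exists_injective_div_le_sum (by omega) hk hp
  choose U hU hc using fun i => isMaximallyEntangled_iff.1 (hme i)
  have htr : ∀ i j, i ≠ j → (U (σ i) * star (U (σ j))).trace = 0 := fun i j hij =>
    trace_eq_zero_of_inner_eq_zero (by norm_num) (hc _) (hc _) (hΨ.2 (hσ.ne hij.symm))
  have e : star (U (σ 0) * star (U (σ 1))) * (U (σ 0) * star (U (σ 2)))
      = U (σ 1) * star (U (σ 2)) := by
    calc _ = U (σ 1) * (star (U (σ 0)) * U (σ 0)) * star (U (σ 2)) := by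
          simp only [star_mul, star_star, Matrix.mul_assoc]
      _ = _ := by rw [mem_unitaryGroup_iff'.1 (hU _), Matrix.mul_one]
  obtain ⟨G, hG, h0⟩ := exists_unitary_conj_diag_eq_zero_three
    (mul_mem (hU (σ 0)) (Unitary.star_mem (hU (σ 1))))
    (mul_mem (hU (σ 0)) (Unitary.star_mem (hU (σ 2))))
    (htr 0 1 (by decide)) (htr 0 2 (by decide)) (by rw [e]; exact htr 1 2 (by decide))
  rw [e] at h0
  refine le_trans (by exact_mod_cast hle)
    (sum_le_optimalSuccessProb (by norm_num) (by omega) le_rfl hU hc hp σ hσ hG ?_)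
  have hsymm : ∀ i j t, (G * (U (σ i) * star (U (σ j))) * star G) t t = 0 →
      (G * (U (σ j) * star (U (σ i))) * star G) t t = 0 := by
    intro i j t h
    have h := congrArg star h
    rw [star_zero, ← star_apply] at h
    simpa only [star_mul, star_star, Matrix.mul_assoc] using h
  intro i j hij t
  obtain ⟨h1, h2, h3⟩ := h0 t
  fin_cases i <;> fin_cases j
  · exact absurd rfl hij
  · exact h1
  · exact h2
  · exact hsymm 0 1 t h1
  · exact absurd rfl hij
  · exact h3
  · exact hsymm 0 2 t h2
  · exact hsymm 1 2 t h3
  · exact absurd rfl hij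

end lower

/-! ### Families of maximally entangled states -/

/-- The Weyl–Heisenberg operators give an orthonormal basis of maximally entangled states. -/
lemma exists_orthonormal_maximallyEntangled {k n : ℕ} (hn : n ≠ 0) (hk : k ≤ n ^ 2) :
    ∃ Ψ : Fin k → Bipartite n n, Orthonormal ℂ Ψ ∧ ∀ i, IsMaximallyEntangled (Ψ i) := by
  have : NeZero n := ⟨hn⟩
  obtain ⟨F, hF, hflat⟩ := exists_unitary_flat n hn
  -- Distinct shifts have disjoint supports, and for equal shifts the rows of `F` are orthogonal.
  -- Flatness of `F` gives equal Schmidt coefficients.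
  let W : Fin n × Fin n → Bipartite n n := fun s =>
    WithLp.toLp 2 fun z => if z.2 = z.1 + s.2 then F s.1 z.1 else 0
  have hW : ∀ s x y, W s (x, y) = if y = x + s.2 then F s.1 x else 0 := fun _ _ _ => rfl
  have hon : Orthonormal ℂ W := by
    rw [orthonormal_iff_ite]
    rintro ⟨a, b⟩ ⟨a', b'⟩
    have h := congrFun (congrFun (mem_unitaryGroup_iff.1 hF) a') a
    simp only [mul_apply, star_apply] at h
    simp only [PiLp.inner_apply, Fintype.sum_prod_type, hW]
    simp only [RCLike.inner_apply, ite_mul, zero_mul, Finset.sum_ite_eq', Finset.mem_univ, if_true,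
      add_right_inj]
    by_cases hb : b = b'
    · subst hb
      simp only [if_true, Prod.mk.injEq, and_true, ← Complex.star_def]
      rw [h, one_apply]
      simp only [eq_comm]
    · simp [hb, Ne.symm hb]
  have hme : ∀ s, IsMaximallyEntangled (W s) := by
    rintro ⟨a, b⟩
    have hs : ((Real.sqrt n : ℝ) : ℂ) ≠ 0 := by
      simp [hn]
    have hsq : ((Real.sqrt n : ℝ) : ℂ) * ((Real.sqrt n : ℝ) : ℂ) = n := by
      rw [← Complex.ofReal_mul, Real.mul_self_sqrt (by positivity)]; simp
    refine isMaximallyEntangled_iff.2 ⟨((Real.sqrt n : ℝ) : ℂ) • coeff (W (a, b)), ?_, ?_⟩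
    · rw [mem_unitaryGroup_iff, star_smul, smul_mul_smul_comm, Complex.star_def,
        Complex.conj_ofReal, hsq]
      ext x x'
      rw [Matrix.smul_apply, mul_apply]
      simp only [star_apply, coeff, of_apply, hW, ite_mul, zero_mul, Finset.sum_ite_eq',
        Finset.mem_univ, if_true, add_left_inj]
      by_cases hx : x = x'
      · subst hx
        rw [if_pos rfl, hflat, one_apply_eq, smul_eq_mul, mul_inv_cancel₀ (by simp [hn])]
      · simp [hx]
    · rw [smul_smul, inv_mul_cancel₀ hs, one_smul]
  let ι : Fin k → Fin n × Fin n := fun i => finProdFinEquiv.symm (Fin.castLE (by rwa [← sq]) i)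
  have hι : ι.Injective := finProdFinEquiv.symm.injective.comp (Fin.castLE_injective _)
  exact ⟨W ∘ ι, hon.comp ι hι, fun i => hme _⟩

/-! ### The minimum is attained -/

section continuity

variable {a a' b b' : ℕ}

lemma continuous_actAlice (X : Matrix (Fin a') (Fin a) ℂ) :
    Continuous (actAlice X : Bipartite a b → Bipartite a' b) := by
  unfold actAlice
  fun_prop

lemma continuous_actBob (Y : Matrix (Fin b') (Fin b) ℂ) :
    Continuous (actBob Y : Bipartite a b → Bipartite a b') := by
  unfold actBob
  fun_prop

lemma Protocol.continuous_guessProbWithin {k : ℕ} (Q : Protocol k a b) (i : Fin k) (r : ℕ) :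
    ∀ {a' b' : ℕ} (s : Q.Node a' b'), Continuous (Q.guessProbWithin i r s) := by
  induction r with
  | zero => intro a' b' s; exact continuous_const
  | succ r ih =>
    intro a' b' s
    cases hs : Q.step s with
    | guess i' =>
      have h : Q.guessProbWithin i (r + 1) s = fun ψ => if i' = i then ‖ψ‖ ^ 2 else 0 := by
        funext ψ
        rw [guessProbWithin, hs]
      rw [h]
      split_ifs <;> fun_prop
    | alice M next =>
      have h : Q.guessProbWithin i (r + 1) s =
          fun ψ => ∑ j, Q.guessProbWithin i r (next j) (actAlice (M.op j) ψ) := by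
        funext ψ
        rw [guessProbWithin, hs]
      rw [h]
      exact continuous_finsetSum _ fun j _ => (ih (next j)).comp (continuous_actAlice _)
    | bob M next =>
      have h : Q.guessProbWithin i (r + 1) s =
          fun ψ => ∑ j, Q.guessProbWithin i r (next j) (actBob (M.op j) ψ) := by
        funext ψ
        rw [guessProbWithin, hs]
      rw [h]
      exact continuous_finsetSum _ fun j _ => (ih (next j)).comp (continuous_actBob _)

end continuity

/-- The families of orthonormal maximally entangled states, with probability distributions. -/
def entangledFamilies (k n : ℕ) : Set ((Fin k → Bipartite n n) × (Fin k → ℝ)) :=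
  {x | (Orthonormal ℂ x.1 ∧ ∀ i, IsMaximallyEntangled (x.1 i)) ∧ x.2 ∈ stdSimplex ℝ (Fin k)}

/-- The existential over bases becomes one polynomial equation: `√n` times the coefficient matrix is
unitary. -/
lemma isClosed_isMaximallyEntangled {n : ℕ} (hn : n ≠ 0) :
    IsClosed {ψ : Bipartite n n | IsMaximallyEntangled ψ} := by
  have hs : ((Real.sqrt n : ℝ) : ℂ) ≠ 0 := by simp [hn]
  have h : {ψ : Bipartite n n | IsMaximallyEntangled ψ} =
      {ψ | (((Real.sqrt n : ℝ) : ℂ) • coeff ψ) * star (((Real.sqrt n : ℝ) : ℂ) • coeff ψ) = 1} := by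
    ext ψ
    simp only [Set.mem_ofPred_eq, isMaximallyEntangled_iff, ← mem_unitaryGroup_iff]
    constructor
    · rintro ⟨U, hU, h⟩
      rwa [h, smul_smul, mul_inv_cancel₀ hs, one_smul]
    · intro h
      exact ⟨_, h, by rw [smul_smul, inv_mul_cancel₀ hs, one_smul]⟩
  have hc : Continuous (coeff : Bipartite n n → Matrix (Fin n) (Fin n) ℂ) :=
    continuous_matrix fun x y => by unfold coeff; simp only [of_apply]; fun_prop
  rw [h]
  exact isClosed_eq (by fun_prop) continuous_const

lemma isCompact_entangledFamilies {k n : ℕ} (hn : n ≠ 0) :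
    IsCompact (entangledFamilies k n) := by
  refine IsCompact.of_isClosed_subset ((isCompact_univ_pi fun _ : Fin k =>
    isCompact_closedBall (0 : Bipartite n n) 1).prod (isCompact_stdSimplex ℝ (Fin k))) ?_ ?_
  · have e : entangledFamilies k n =
        ((⋂ (i) (j), {x : (Fin k → Bipartite n n) × (Fin k → ℝ) |
            inner ℂ (x.1 i) (x.1 j) = if i = j then (1 : ℂ) else 0}) ∩
          ⋂ i, (fun x : (Fin k → Bipartite n n) × (Fin k → ℝ) => x.1 i) ⁻¹' {ψ : Bipartite n n | IsMaximallyEntangled ψ}) ∩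
          Prod.snd ⁻¹' stdSimplex ℝ (Fin k) := by
      ext x
      simp [entangledFamilies, orthonormal_iff_ite]
    rw [e]
    refine IsClosed.inter (IsClosed.inter ?_ ?_) ((isClosed_stdSimplex _ _).preimage continuous_snd)
    · exact isClosed_iInter fun i => isClosed_iInter fun j =>
        isClosed_eq (by fun_prop) continuous_const
    · exact isClosed_iInter fun i => (isClosed_isMaximallyEntangled hn).preimage (by fun_prop)
  · rintro ⟨Ψ, p⟩ ⟨⟨hΨ, -⟩, hp⟩
    exact ⟨fun i _ => by simp [hΨ.1 i], hp⟩

/-- A near-optimal protocol, truncated after finitely many rounds, has a success probability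
continuous in the states and weights. Termination does not involve the family, so the same protocol
competes at all nearby points. -/
lemma lowerSemicontinuousOn_optimalSuccessProb {k n : ℕ} (hk : 0 < k) :
    LowerSemicontinuousOn (fun x : (Fin k → Bipartite n n) × (Fin k → ℝ) =>
      optimalSuccessProb x.1 x.2) (entangledFamilies k n) := by
  rintro ⟨Ψ, p⟩ - y hy
  obtain ⟨Q₀, hQ₀⟩ := exists_terminatesAlmostSurely (a := n) (b := n) hk
  obtain ⟨_, ⟨Q, hQ, rfl⟩, hyQ⟩ := exists_lt_of_lt_csSup
    (s := {x | ∃ Q : Protocol k n n, Q.TerminatesAlmostSurely ∧ Q.successProb Ψ p = x})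
    ⟨_, Q₀, hQ₀, rfl⟩ hy
  have ht : Tendsto (fun r => ∑ i, p i * Q.guessProbWithin i r Q.start (Ψ i)) atTop
      (𝓝 (Q.successProb Ψ p)) :=
    tendsto_finsetSum _ fun i _ => (Q.tendsto_guessProbWithin i (Ψ i)).const_mul _
  obtain ⟨r, hr⟩ := (ht.eventually (lt_mem_nhds hyQ)).exists
  have hcont : Continuous fun x : (Fin k → Bipartite n n) × (Fin k → ℝ) =>
      ∑ i, x.2 i * Q.guessProbWithin i r Q.start (x.1 i) := by
    refine continuous_finsetSum _ fun i _ => Continuous.mul (by fun_prop) ?_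
    exact (Q.continuous_guessProbWithin i r Q.start).comp (by fun_prop)
  filter_upwards [mem_nhdsWithin_of_mem_nhds (hcont.continuousAt.eventually (lt_mem_nhds hr)),
    self_mem_nhdsWithin] with x hx hxs
  refine hx.trans_le (le_trans ?_ (Protocol.successProb_le_optimalSuccessProb hQ _ hxs.2))
  exact Finset.sum_le_sum fun i _ =>
    mul_le_mul_of_nonneg_left (Q.guessProbWithin_le_guessProb i r _) (hxs.2.1 i)

lemma optimalValues_eq_image (k n : ℕ) :
    optimalValues k n = (fun x : (Fin k → Bipartite n n) × (Fin k → ℝ) =>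
      optimalSuccessProb x.1 x.2) '' entangledFamilies k n := by
  ext x
  simp [optimalValues, entangledFamilies, and_assoc]

lemma entangledFamilies_nonempty {k n : ℕ} (hn : n ≠ 0) (hk : 0 < k) (hkn : k ≤ n ^ 2) :
    (entangledFamilies k n).Nonempty := by
  have : NeZero k := ⟨hk.ne'⟩
  obtain ⟨Ψ, hΨ⟩ := exists_orthonormal_maximallyEntangled hn hkn
  exact ⟨⟨Ψ, Pi.single 0 1⟩, hΨ, single_mem_stdSimplex ℝ 0⟩

/-- The minimum that defines `fme k n` is attained. -/
lemma isLeast_fme {k n : ℕ} (hn : n ≠ 0) (hk : 0 < k) (hkn : k ≤ n ^ 2) :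
    IsLeast (optimalValues k n) (fme k n) := by
  obtain ⟨x, hx, hmin⟩ := (lowerSemicontinuousOn_optimalSuccessProb hk).exists_isMinOn
    (entangledFamilies_nonempty hn hk hkn) (isCompact_entangledFamilies hn)
  have h : IsLeast (optimalValues k n) (optimalSuccessProb x.1 x.2) := by
    rw [optimalValues_eq_image]
    exact ⟨⟨x, hx, rfl⟩, by rintro _ ⟨y, hy, rfl⟩; exact hmin hy⟩
  rwa [fme, h.csInf_eq]

/-- Equiprobable maximally entangled states are identified with probability at most `n / k`. -/
lemma fme_le {k n : ℕ} (hn : n ≠ 0) (hk : 0 < k) (hkn : k ≤ n ^ 2) :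
    fme k n ≤ (n : ℝ) / k := by
  obtain ⟨Ψ, hΨ, hme⟩ := exists_orthonormal_maximallyEntangled hn hkn
  have hp : (fun _ => (k : ℝ)⁻¹) ∈ stdSimplex ℝ (Fin k) :=
    ⟨fun _ => by positivity, by simp [hk.ne']⟩
  refine ((isLeast_fme hn hk hkn).2 ⟨Ψ, _, hΨ, hme, hp, rfl⟩).trans ?_
  obtain ⟨Q₀, hQ₀⟩ := exists_terminatesAlmostSurely (a := n) (b := n) hk
  refine csSup_le ⟨_, Q₀, hQ₀, rfl⟩ ?_
  rintro _ ⟨Q, -, rfl⟩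
  choose U hU hc using fun i => isMaximallyEntangled_iff.1 (hme i)
  have h := Q.sum_guessProb_le_of_unitary hU hc
  rw [norm_sq_inv_sqrt, inv_mul_cancel_left₀ (by simp [hn])] at h
  rw [Protocol.successProb, ← Finset.mul_sum, div_eq_inv_mul]
  gcongr

end LOCC

theorem mainTheorem4 :
    (∀ n k : ℕ, 2 ≤ n → n ≤ k → k ≤ n ^ 2 →
      IsLeast (LOCC.optimalValues k n) (LOCC.fme k n) ∧
      2 / (k : ℝ) ≤ LOCC.fme k n ∧ LOCC.fme k n ≤ (n : ℝ) / (k : ℝ)) ∧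
    (∀ k : ℕ, 3 ≤ k → k ≤ 9 → LOCC.fme k 3 = 3 / (k : ℝ)) := by
  refine ⟨fun n k hn hnk hk => ?_, fun k hk hk9 => ?_⟩
  · have hleast := LOCC.isLeast_fme (by omega) (by omega) hk
    refine ⟨hleast, ?_, LOCC.fme_le (by omega) (by omega) hk⟩
    -- Attainment reduces the bound on the minimum to the bound for a single family.
    obtain ⟨Ψ, p, hΨ, hme, hp, h⟩ := hleast.1
    rw [← h]
    exact LOCC.two_div_le_optimalSuccessProb hn (by omega) hΨ hme hp
  · have hleast := LOCC.isLeast_fme (k := k) (n := 3) (by norm_num) (by omega) (by omega)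
    refine le_antisymm ?_ ?_
    · exact_mod_cast LOCC.fme_le (k := k) (n := 3) (by norm_num) (by omega) (by omega)
    · obtain ⟨Ψ, p, hΨ, hme, hp, h⟩ := hleast.1
      rw [← h]
      exact LOCC.three_div_le_optimalSuccessProb hk hΨ hme hp
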